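/- Let $n\ge 2$, $1\le p\le n-1$, $\lambda\ge 0$ be integers and $\epsilon\in\mathbb C^\times$. **Quiver.** Take the quiver with gauge nodes $1,\dots,n-1$, loops $C_k$, arrows $A_k:k\to k+1$, $B_k:k+1\to k$ ($1\le k\le n-2$) and framing arrows $R_k$ (into $k$), $S_k$ (out of $k$) at every node; the weights of $C,A,B,R$ are $\epsilon,-\frac\epsilon2,-\frac\epsilon2,0$, that of $S_p$ is $-\lambda\epsilon$, that of $S_k$, $k\neq p$, is $0$; the R-charges of $C,A,B,R,S$ are $0,1,1,0,2$. The F-terms are those of ${\cal W}={\rm Tr}[A_1C_1B_1+\sum_{a=2}^{n-2}(A_aC_aB_a-B_{a-1}C_aA_{a-1})-B_{n-2}C_{n-1}A_{n-2}+C_p^\lambda R_pS_p]$. **States.** A state is a Gelfand–Tsetlin pattern $\mu=(m_{i,k})_{1\le i\le k\le n}$ of non-negative integers, $m_{i,k+1}\ge m_{i,k}\ge m_{i+1,k+1}$, with top row $m_{i,n}=\lambda$ for $i\le n-p$ and $m_{i,n}=0$ for $i>n-p$. Put $l_{i,k}=m_{i,k}-i$, $a[k]=\max\{1,k-p+1\}$,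 $b[k]=\min\{n-p,k\}$. Let $V_k=\bigoplus_{i=a[k]}^{b[k]}\nu_{i,k}$, where $\nu_{i,k}$ has the basis $(i,l)$, $0\le l<m_{i,k}$; the atom $(i,l)$ has weight $\phi=l\epsilon-(i-a[k])\epsilon-|k-p|\frac\epsilon2$ and R-charge $2(i-a[k])+|k-p|$; $\Phi_k={\rm diag}(\phi)$. For $1\le k\le n-1$, $\mu^{j}_{k,k+1}$ (resp. $\mu^j_{k,k-1}$) denotes $\mu$ with $m_{j,k}$ replaced by $m_{j,k}+1$ (resp. $m_{j,k}-1$), where this is again a pattern; other terms are omitted from all sums. **Euler classes.** Characters are finitely supported functions from weights to $\mathbb Z$. For patterns $\mu',\mu$ with spaces $V',V$ let $N(\mu',\mu)$ be the class of (fields $A,B,C$) $-$ (gauge transformations) $-$ (F-terms) $+$ (relations among F-terms), plus the framing directions $\delta R_k,\delta S_k$ at all nodes. Here an arrow $s\to t$ of weight $h$ and R-charge $r$ contributes $\mathrm{Hom}(V'_s,V_t)$, the matrix unit taking the atom $y$ to $x$ having weight $\phi_x-\phi_y-h$ and being counted only if it does not lower the R-charge ($R_x-R_y-r\ge0$); gauge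 transformations are such endo-arrows with $(h,r)=(0,0)$, the F-term of an arrow goes in the opposite direction with $(-h,2-r)$, the relations among F-terms have $(0,2)$; $\delta R_k$ contributes the weights $\phi_x$ ($x\in V_k$) and $\delta S_k$ the weights $-\phi_y-h_{S_k}$ ($y\in V'_k$), all of them counted. The regularised (virtual) tangent space at $\mu$ is $T_\mu=N(\mu,\mu)$, and that of the incidence locus at $(\mu,\mu')$, $\mu'=\mu+\square$, is $T_{\mu,\mu'}=T_\mu+T_{\mu'}-N(\mu',\mu)$. With ${\rm Eul}\,{\cal N}=(-1)^{\lfloor m_0/2\rfloor}\prod_{w\ne0}w^{m_w}$ ($m_w$ the multiplicity of $w$), put ${\rm Eul}_\mu=(-1)^{|\mu|}{\rm Eul}\,T_\mu$, ${\rm Eul}_{\mu,\mu'}=(-1)^{|\mu|}{\rm Eul}\,T_{\mu,\mu'}$, where $|\mu|=\sum_{k=1}^{n-1}\dim V_k$ (i.e. the directions $\delta S$ are oriented oppositely), and $${\bf E}[\mu\to\mu']=\frac{{\rm Eul}_\mu}{{\rm Eul}_{\mu,\mu'}},\qquad {\bf F}[\mu'\to\mu]=\frac{{\rm Eul}_{\mu'}}{{\rm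 Eul}_{\mu,\mu'}}.$$ **Theorem.** (1) Let $I(r,c)$ be the $r\times c$ matrix with ones on the main diagonal, $C(r)$ the $r\times r$ matrix with ones right below the diagonal, $O$ the zero matrix. For every $\mu$ let $\bar C_k$ be block diagonal with blocks $C(m_{i,k})$; let $\bar A_k$ have the block $I(m_{i+1,k+1},m_{i,k})$ at (block row $i+1$, block column $i$) and $\bar B_k$ the block $I(m_{i,k},m_{i,k+1})$ at (block row $i$, block column $i$), $i$ being the labels of the summands $\nu_{i,k}$, and $O$ elsewhere; let $\bar R_p$ have the block $I(m_{1,p},1)$ at $i=1$ and $O$ elsewhere, $\bar R_k=0$ for $k\neq p$, $\bar S_k=0$. Then different atoms of the same node have different positions (weight, R-charge); every one of these matrices has the entry $1$ exactly where the arrow takes the position of the source atom to that of the target atom (the framing nodes being at $(0,0)$), and $0$ elsewhere; they satisfy the F-terms $C_iB_i=B_iC_{i+1}$, $A_iC_i=C_{i+1}A_i$, $B_iA_i=A_{i-1}B_{i-1}$ ($2\le i\le n-2$), $B_1A_1=0$, $A_{n-2}B_{n-2}=0$, $C_p^\lambda R_p=0$ and the fixed-point equations $[\Phi_k,C_k]=\epsilon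 C_k$, $\Phi_{k+1}A_k-A_k\Phi_k=-\frac\epsilon2A_k$, $\Phi_kB_k-B_k\Phi_{k+1}=-\frac\epsilon2B_k$, $\Phi_kR_k=0$, $-S_p\Phi_p=-\lambda\epsilon S_p$; and every $V_k$ is spanned by the vectors obtained by applying paths in $A,B,C$ to $R_p$. (2) For each $\mu\to\mu'=\mu^j_{k,k+1}$ the classes ${\rm Eul}_\mu,{\rm Eul}_{\mu'},{\rm Eul}_{\mu,\mu'}$ are non-zero. Let $\langle w\rangle=w$ for $w\ne0$ and $\langle0\rangle=1$. For $k\ne p$, $${\bf E}[\mu\to\mu_{k,k+1}^j]=\frac{\prod_{i=1}^{j}(l_{i,k+1}-l_{j,k})\prod_{i=1}^{j-1}(l_{i,k-1}-l_{j,k}-1)}{\prod_{i=1}^{j-1}(l_{i,k}-l_{j,k})(l_{i,k}-l_{j,k}-1)}\cdot\frac1{\langle l_{j,k}\epsilon+a[k]\epsilon-|k-p|\frac\epsilon2\rangle},$$ $${\bf F}[\mu\to\mu_{k,k-1}^j]=-\frac{\prod_{i=j+1}^{k+1}(l_{i,k+1}-l_{j,k}+1)\prod_{i=j}^{k-1}(l_{i,k-1}-l_{j,k})}{\prod_{i=j+1}^{k}(l_{i,k}-l_{j,k}+1)(l_{i,k}-l_{j,k})}\,\Bigl\langle(l_{j,k}-1)\epsilon+a[k]\epsilon-|k-p|\tfrac\epsilon2\Bigr\rangle,$$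 and for $k=p$, $${\bf E}[\mu\to\mu_{p,p+1}^j]=-\frac{\prod_{i=2}^{j}(l_{i,p+1}-l_{j,p})\prod_{i=1}^{j-1}(l_{i,p-1}-l_{j,p}-1)}{\prod_{i=1}^{j-1}(l_{i,p}-l_{j,p})(l_{i,p}-l_{j,p}-1)}\cdot\frac1\epsilon,$$ $${\bf F}[\mu\to\mu_{p,p-1}^j]=\frac{(l_{1,p+1}-l_{j,p}+1)\prod_{i=j+1}^{p+1}(l_{i,p+1}-l_{j,p}+1)\prod_{i=j}^{p-1}(l_{i,p-1}-l_{j,p})}{\prod_{i=j+1}^{p}(l_{i,p}-l_{j,p}+1)(l_{i,p}-l_{j,p})}\,\epsilon.$$ (3) Let $e^{(k)}(z)|\mu\rangle=\sum_{j=a[k]}^{b[k]}\frac{{\bf E}[\mu\to\mu^j_{k,k+1}]}{z-\phi}|\mu^j_{k,k+1}\rangle=\sum_{r\ge0}e_r^{(k)}z^{-r-1}|\mu\rangle$, $\phi=l_{j,k}\epsilon+a[k]\epsilon-|k-p|\frac\epsilon2$ being the weight of the added atom, and likewise $f^{(k)}(z)|\mu\rangle=\sum_j\frac{{\bf F}[\mu\to\mu^j_{k,k-1}]}{z-\phi}|\mu^j_{k,k-1}\rangle$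 with the weight $\phi=(l_{j,k}-1)\epsilon+a[k]\epsilon-|k-p|\frac\epsilon2$ of the removed atom. There are square roots $N_\mu$, $N_\mu^2={\rm Eul}_\mu\neq0$, such that in the basis of normalised states $N_\mu^{-1}|\mu\rangle$ the level-zero generators $e_0^{(k)},f_0^{(k)}$, $1\le k\le n-1$, act exactly by the Gelfand–Tsetlin formulas for $\mathfrak{sl}_n$ on the patterns with the top row $(\lambda^{n-p},0^p)$: $e^{(k)}_0|\mu\rangle=\sum_{j=1}^k a^j_{k,k+1}|\mu^j_{k,k+1}\rangle$, $f^{(k)}_0|\mu\rangle=\sum_{j=1}^k b^j_{k,k-1}|\mu^j_{k,k-1}\rangle$ (only $a[k]\le j\le b[k]$ contribute), where $$a_{k,k+1}^j=\left[-\frac{\prod_{i=1}^{k+1}(l_{i,k+1}-l_{j,k})\prod_{i=1}^{k-1}(l_{i,k-1}-l_{j,k}-1)}{\prod_{1\le i\le k,\,i\ne j}(l_{i,k}-l_{j,k})(l_{i,k}-l_{j,k}-1)}\right]^{1/2},$$ $$b_{k,k-1}^j=\left[-\frac{\prod_{i=1}^{k+1}(l_{i,k+1}-l_{j,k}+1)\prod_{i=1}^{k-1}(l_{i,k-1}-l_{j,k})}{\prod_{1\le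 i\le k,\,i\ne j}(l_{i,k}-l_{j,k}+1)(l_{i,k}-l_{j,k})}\right]^{1/2}$$ are the positive square roots; the radicands are positive for all the moves that occur. -/

import Mathlib

open scoped Matrix

noncomputable section

namespace RectYangian

/-! ## Gelfand-Tsetlin patterns -/

/-- Gelfand-Tsetlin patterns `(m_{i,k})_{1 ≤ i ≤ k ≤ n}` with prescribed top row `m_{i,n} = top i`.
The entries are stored as a function of two natural numbers that vanishes off the triangle, so that
a pattern is determined by its entries in the triangle. -/
@[ext]
structure GTPattern (n : ℕ) (top : ℕ → ℕ) where
  m : ℕ → ℕ → ℕ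
  top_row : ∀ i, 1 ≤ i → i ≤ n → m i n = top i
  left_ge : ∀ i k, 1 ≤ i → i ≤ k → k < n → m i k ≤ m i (k + 1)
  right_ge : ∀ i k, 1 ≤ i → i ≤ k → k < n → m (i + 1) (k + 1) ≤ m i k
  outside : ∀ i k, ¬(1 ≤ i ∧ i ≤ k ∧ k ≤ n) → m i k = 0

/-- The shifted entries `l_{i,k} = m_{i,k} - i`. -/
def GTPattern.l {n : ℕ} {top : ℕ → ℕ} (μ : GTPattern n top) (i k : ℕ) : ℤ := (μ.m i k : ℤ) - i

/-- `μ'` arises from `μ` by replacing `m_{j,k}` with `m_{j,k} + 1`. -/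
def IsRaise {n : ℕ} {top : ℕ → ℕ} (k j : ℕ) (μ μ' : GTPattern n top) : Prop :=
  1 ≤ j ∧ j ≤ k ∧ k < n ∧
    ∀ i r, μ'.m i r = if i = j ∧ r = k then μ.m i r + 1 else μ.m i r

/-- Radicand of the Gelfand-Tsetlin raising coefficient `a^j_{k,k+1}`. -/
def gtRadicandE {n : ℕ} {top : ℕ → ℕ} (k j : ℕ) (μ : GTPattern n top) : ℝ :=
  (-1) * ((∏ i ∈ Finset.Icc 1 (k + 1), ((μ.l i (k + 1) : ℝ) - μ.l j k)) *
      ∏ i ∈ Finset.Icc 1 (k - 1), ((μ.l i (k - 1) : ℝ) - μ.l j k - 1)) /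
    ∏ i ∈ (Finset.Icc 1 k).erase j,
      (((μ.l i k : ℝ) - μ.l j k) * ((μ.l i k : ℝ) - μ.l j k - 1))

/-- Radicand of the Gelfand-Tsetlin lowering coefficient `b^j_{k,k-1}`. -/
def gtRadicandF {n : ℕ} {top : ℕ → ℕ} (k j : ℕ) (μ : GTPattern n top) : ℝ :=
  (-1) * ((∏ i ∈ Finset.Icc 1 (k + 1), ((μ.l i (k + 1) : ℝ) - μ.l j k + 1)) *
      ∏ i ∈ Finset.Icc 1 (k - 1), ((μ.l i (k - 1) : ℝ) - μ.l j k)) /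
    ∏ i ∈ (Finset.Icc 1 k).erase j,
      (((μ.l i k : ℝ) - μ.l j k + 1) * ((μ.l i k : ℝ) - μ.l j k))

/-- The operator `|μ⟩ ↦ ∑_{j ∈ s} c j μ μ' |μ'⟩` on the space with basis the patterns, where `μ'` is
the pattern with `m_{j,k}` raised by one; the `j` for which there is no such pattern are omitted. -/
def raisingOp {n : ℕ} {top : ℕ → ℕ} (k : ℕ) (s : Finset ℕ)
    (c : ℕ → GTPattern n top → GTPattern n top → ℂ) :
    (GTPattern n top →₀ ℂ) →ₗ[ℂ] (GTPattern n top →₀ ℂ) :=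
  open Classical in
  Finsupp.linearCombination ℂ fun μ => ∑ j ∈ s,
    if h : ∃ μ', IsRaise k j μ μ' then Finsupp.single h.choose (c j μ h.choose) else 0

/-- The operator `|μ⟩ ↦ ∑_{j ∈ s} c j μ μ' |μ'⟩` on the space with basis the patterns, where `μ'` is
the pattern with `m_{j,k}` lowered by one; the `j` for which there is no such pattern are omitted. -/
def loweringOp {n : ℕ} {top : ℕ → ℕ} (k : ℕ) (s : Finset ℕ)
    (c : ℕ → GTPattern n top → GTPattern n top → ℂ) :
    (GTPattern n top →₀ ℂ) →ₗ[ℂ] (GTPattern n top →₀ ℂ) :=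
  open Classical in
  Finsupp.linearCombination ℂ fun μ => ∑ j ∈ s,
    if h : ∃ μ', IsRaise k j μ' μ then Finsupp.single h.choose (c j μ h.choose) else 0

/-- The Gelfand-Tsetlin operator of the simple root vector `e_k` of `sl_n`. -/
def gtE {n : ℕ} {top : ℕ → ℕ} (k : ℕ) :
    (GTPattern n top →₀ ℂ) →ₗ[ℂ] (GTPattern n top →₀ ℂ) :=
  raisingOp k (Finset.Icc 1 k) fun j μ _ => (Real.sqrt (gtRadicandE k j μ) : ℂ)

/-- The Gelfand-Tsetlin operator of the simple root vector `f_k` of `sl_n`. -/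
def gtF {n : ℕ} {top : ℕ → ℕ} (k : ℕ) :
    (GTPattern n top →₀ ℂ) →ₗ[ℂ] (GTPattern n top →₀ ℂ) :=
  loweringOp k (Finset.Icc 1 k) fun j μ _ => (Real.sqrt (gtRadicandF k j μ) : ℂ)

/-! ## Quiver representations -/

/-- The fields of the framed triple quiver of type `A_{n-1}`, with gauge nodes `1, …, n - 1`:
`A_k : V_k → V_{k+1}`, `B_k : V_{k+1} → V_k`, `C_k : V_k → V_k`, `R_k : ℂ → V_k`, `S_k : V_k → ℂ`.
The space `V_k` has a basis indexed by `ι k`. Only the values of the fields at the nodes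
`1, …, n - 1` and along the edges `1, …, n - 2` are used. -/
structure QuiverRep (ι : ℕ → Type) where
  A : ∀ k, Matrix (ι (k + 1)) (ι k) ℂ
  B : ∀ k, Matrix (ι k) (ι (k + 1)) ℂ
  C : ∀ k, Matrix (ι k) (ι k) ℂ
  R : ∀ k, Matrix (ι k) (Fin 1) ℂ
  S : ∀ k, Matrix (Fin 1) (ι k) ℂ

namespace QuiverRep

variable {ι : ℕ → Type} [∀ k, Fintype (ι k)] [∀ k, DecidableEq (ι k)]

/-- The F-term relations of the superpotential
`Tr [A_1C_1B_1 + ∑_{a=2}^{n-2} (A_aC_aB_a - B_{a-1}C_aA_{a-1}) - B_{n-2}C_{n-1}A_{n-2}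
  + C_p^λ R_p S_p]` on the locus `S = 0`. -/
def FTerms (q : QuiverRep ι) (n p lam : ℕ) : Prop :=
  (∀ i, 1 ≤ i → i ≤ n - 2 → q.C i * q.B i = q.B i * q.C (i + 1)) ∧
  (∀ i, 1 ≤ i → i ≤ n - 2 → q.A i * q.C i = q.C (i + 1) * q.A i) ∧
  (∀ i, 1 ≤ i → i + 1 ≤ n - 2 → q.B (i + 1) * q.A (i + 1) = q.A i * q.B i) ∧
  (3 ≤ n → q.B 1 * q.A 1 = 0) ∧
  (3 ≤ n → q.A (n - 2) * q.B (n - 2) = 0) ∧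
  q.C p ^ lam * q.R p = 0 ∧
  ∀ k, 1 ≤ k → k ≤ n - 1 → q.S k = 0

/-- The equations of a fixed point of the equivariant vector field, for given `Φ_k = diag (φ k)`. -/
def IsFixed (q : QuiverRep ι) (n p lam : ℕ) (ε : ℂ) (φ : ∀ k, ι k → ℂ) : Prop :=
  (∀ k, 1 ≤ k → k ≤ n - 1 →
    Matrix.diagonal (φ k) * q.C k - q.C k * Matrix.diagonal (φ k) = ε • q.C k) ∧
  (∀ k, 1 ≤ k → k ≤ n - 2 →
    Matrix.diagonal (φ (k + 1)) * q.A k - q.A k * Matrix.diagonal (φ k) = (-ε / 2) • q.A k) ∧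
  (∀ k, 1 ≤ k → k ≤ n - 2 →
    Matrix.diagonal (φ k) * q.B k - q.B k * Matrix.diagonal (φ (k + 1)) = (-ε / 2) • q.B k) ∧
  (∀ k, 1 ≤ k → k ≤ n - 1 → Matrix.diagonal (φ k) * q.R k = 0) ∧
  -(q.S p * Matrix.diagonal (φ p)) = (-(lam * ε)) • q.S p

/-- The vectors obtained by applying paths of the quiver to the framing vector `R_p`. -/
inductive PathVec (q : QuiverRep ι) (n p : ℕ) : ∀ k, (ι k → ℂ) → Prop
  | root : PathVec q n p p fun x => q.R p x 0
  | stepC (k : ℕ) (v : ι k → ℂ) : PathVec q n p k v → PathVec q n p k (q.C k *ᵥ v)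
  | stepA (k : ℕ) (v : ι k → ℂ) (h₁ : 1 ≤ k) (h₂ : k ≤ n - 2) :
      PathVec q n p k v → PathVec q n p (k + 1) (q.A k *ᵥ v)
  | stepB (k : ℕ) (v : ι (k + 1) → ℂ) (h₁ : 1 ≤ k) (h₂ : k ≤ n - 2) :
      PathVec q n p (k + 1) v → PathVec q n p k (q.B k *ᵥ v)

/-- Cyclic stability: every `V_k` is spanned by paths applied to `R_p`. -/
def IsCyclic (q : QuiverRep ι) (n p : ℕ) : Prop :=
  ∀ k, 1 ≤ k → k ≤ n - 1 → Submodule.span ℂ {v : ι k → ℂ | q.PathVec n p k v} = ⊤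

/-- The atoms do not overlap, and the matrix of each arrow has entry `1` exactly where the arrow
takes the position (equivariant weight, R-charge) of the source atom to that of the target atom.
The arrows `C, A, B, R, S` have R-charges `0, 1, 1, 0, 2` and weights
`ε, -ε/2, -ε/2, 0, -λε` (`0` for `S_k` with `k ≠ p`); framing nodes sit at the position `(0, 0)`. -/
def IsCrystal (q : QuiverRep ι) (n p lam : ℕ) (ε : ℂ) (φ : ∀ k, ι k → ℂ) (R : ∀ k, ι k → ℤ) :
    Prop :=
  (∀ k, 1 ≤ k → k ≤ n - 1 → Function.Injective fun x : ι k => (φ k x, R k x)) ∧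
  (∀ k, 1 ≤ k → k ≤ n - 1 → ∀ x y, (q.C k y x = 0 ∨ q.C k y x = 1) ∧
    (q.C k y x = 1 ↔ φ k y = φ k x + ε ∧ R k y = R k x)) ∧
  (∀ k, 1 ≤ k → k ≤ n - 2 → ∀ x y, (q.A k y x = 0 ∨ q.A k y x = 1) ∧
    (q.A k y x = 1 ↔ φ (k + 1) y = φ k x - ε / 2 ∧ R (k + 1) y = R k x + 1)) ∧
  (∀ k, 1 ≤ k → k ≤ n - 2 → ∀ x y, (q.B k y x = 0 ∨ q.B k y x = 1) ∧
    (q.B k y x = 1 ↔ φ k y = φ (k + 1) x - ε / 2 ∧ R k y = R (k + 1) x + 1)) ∧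
  (∀ k, 1 ≤ k → k ≤ n - 1 → ∀ y, (q.R k y 0 = 0 ∨ q.R k y 0 = 1) ∧
    (q.R k y 0 = 1 ↔ φ k y = 0 ∧ R k y = 0)) ∧
  (∀ k, 1 ≤ k → k ≤ n - 1 → ∀ x, (q.S k 0 x = 0 ∨ q.S k 0 x = 1) ∧
    (q.S k 0 x = 1 ↔ 0 = φ k x + (if k = p then -(lam * ε) else 0) ∧ 0 = R k x + 2))

end QuiverRep

/-! ## The representation `Υ_{p,λ}` -/

/-- The top row `(λ, …, λ, 0, …, 0)` with `n - p` entries `λ` and `p` entries `0`. -/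
def rectTop (n p lam : ℕ) (i : ℕ) : ℕ := if i ≤ n - p then lam else 0

/-- The patterns that label the states of `Υ_{p,λ}`. -/
abbrev RectPattern (n p lam : ℕ) : Type := GTPattern n (rectTop n p lam)

/-- `a[k] = max {1, k - p + 1}`. -/
def aIdx (p k : ℕ) : ℕ := max 1 (k + 1 - p)

/-- `b[k] = min {n - p, k}`. -/
def bIdx (n p k : ℕ) : ℕ := min (n - p) k

section

variable {n p lam : ℕ}

/-- The index set of the basis of `V_k = ⨁_{i = a[k]}^{b[k]} ν_{i,k}`, `dim ν_{i,k} = m_{i,k}`, that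
is, the atoms of colour `k`: pairs of a block `i` and a position `0 ≤ l < m_{i,k}` in it.
(It is empty unless `1 ≤ k ≤ n - 1`.) -/
abbrev Atom (μ : RectPattern n p lam) (k : ℕ) : Type :=
  (i : Finset.Icc (aIdx p k) (bIdx n p k)) × Fin (μ.m i k)

/-- The equivariant weight of an atom. -/
def phi (ε : ℂ) (μ : RectPattern n p lam) (k : ℕ) (x : Atom μ k) : ℂ :=
  (x.2 : ℕ) * ε - (((x.1 : ℕ) : ℂ) - aIdx p k) * ε - ((|(k : ℤ) - p| : ℤ) : ℂ) * (ε / 2)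

/-- The R-charge of an atom. -/
def rCharge (μ : RectPattern n p lam) (k : ℕ) (x : Atom μ k) : ℤ :=
  2 * (((x.1 : ℕ) : ℤ) - aIdx p k) + |(k : ℤ) - p|

/-- `I(r, c)`: the `r × c` matrix with ones on the main diagonal. -/
def matI (r c : ℕ) : Matrix (Fin r) (Fin c) ℂ :=
  Matrix.of fun x y => if (x : ℕ) = y then 1 else 0

/-- `C(r)`: the lower shift matrix, with ones right below the main diagonal (written for two sizes
`r, c`, so that it can be an entry of a block matrix; it is used with `r = c`). -/
def matC (r c : ℕ) : Matrix (Fin r) (Fin c) ℂ :=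
  Matrix.of fun x y => if (x : ℕ) = y + 1 then 1 else 0

/-- `O(r, c)`: the zero matrix. -/
def matO (r c : ℕ) : Matrix (Fin r) (Fin c) ℂ := 0

/-- The block matrix with given blocks. -/
def blocks {α β : Type} {r : α → ℕ} {c : β → ℕ}
    (M : ∀ i j, Matrix (Fin (r i)) (Fin (c j)) ℂ) :
    Matrix ((i : α) × Fin (r i)) ((j : β) × Fin (c j)) ℂ :=
  Matrix.of fun x y => M x.1 y.1 x.2 y.2

/-- The expectation values of the fields at the fixed point `μ`, in block form:
`C_k` is block diagonal with blocks `C(m_{i,k})`; the block of `A_k` in the block row `i'` and the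
block column `i` is `I(m_{i',k+1}, m_{i,k})` if `i' = i + 1`; the one of `B_k` in the block row `i`
and the block column `i'` is `I(m_{i,k}, m_{i',k+1})` if `i = i'`; the one of `R_p` in the block row
`i` is `I(m_{1,p}, 1)` if `i = 1`; all the others vanish. -/
def fixedPoint (μ : RectPattern n p lam) : QuiverRep (Atom μ) where
  A k := blocks (r := fun i : Finset.Icc (aIdx p (k + 1)) (bIdx n p (k + 1)) => μ.m i (k + 1))
    (c := fun i : Finset.Icc (aIdx p k) (bIdx n p k) => μ.m i k)
    fun i' i => if (i' : ℕ) = i + 1 then matI _ _ else matO _ _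
  B k := blocks (r := fun i : Finset.Icc (aIdx p k) (bIdx n p k) => μ.m i k)
    (c := fun i : Finset.Icc (aIdx p (k + 1)) (bIdx n p (k + 1)) => μ.m i (k + 1))
    fun i i' => if (i : ℕ) = i' then matI _ _ else matO _ _
  C k := blocks (r := fun i : Finset.Icc (aIdx p k) (bIdx n p k) => μ.m i k)
    (c := fun i : Finset.Icc (aIdx p k) (bIdx n p k) => μ.m i k)
    fun i' i => if i' = i then matC _ _ else matO _ _
  R k := Matrix.of fun x y =>
    (if k = p ∧ (x.1 : ℕ) = 1 then matI (μ.m x.1 k) 1 else matO (μ.m x.1 k) 1) x.2 y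
  S _ := 0

/-! ### Equivariant weights of tangent spaces

A finite-dimensional (virtual) space graded by weights is recorded by its character, the finitely
supported function that gives the multiplicity of each weight. -/

/-- The character of the R-charge non-lowering part of `Hom(V'_s, V_t)`, for an arrow `s → t` of
weight `h` and R-charge `r`, where `V'`, `V` are the spaces at `μ'`, `μ`. The matrix unit that takes
an atom `y` to an atom `x` has weight `φ_x - φ_y - h`, and raises the R-charge by
`R_x - R_y - r`. -/
def homChar (ε : ℂ) (μ' μ : RectPattern n p lam) (s t : ℕ) (h : ℂ) (r : ℤ) : ℂ →₀ ℤ :=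
  ∑ y : Atom μ' s, ∑ x : Atom μ t,
    if 0 ≤ rCharge μ t x - rCharge μ' s y - r then
      Finsupp.single (phi ε μ t x - phi ε μ' s y - h) 1 else 0

/-- The character of the deformation complex of the unframed quiver with superpotential: (fields) -
(gauge transformations) - (F-terms) + (relations between the F-terms). The F-term of an arrow
`s → t` of weight `h` and R-charge `r` goes `t → s` and has weight `-h` and R-charge `2 - r`. -/
def unframedChar (ε : ℂ) (μ' μ : RectPattern n p lam) : ℂ →₀ ℤ :=
  (∑ k ∈ Finset.Icc 1 (n - 1),
    (homChar ε μ' μ k k ε 0 - homChar ε μ' μ k k 0 0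
      - homChar ε μ' μ k k (-ε) 2 + homChar ε μ' μ k k 0 2)) +
  ∑ k ∈ Finset.Icc 1 (n - 2),
    (homChar ε μ' μ k (k + 1) (-ε / 2) 1 + homChar ε μ' μ (k + 1) k (-ε / 2) 1
      - homChar ε μ' μ (k + 1) k (ε / 2) 1 - homChar ε μ' μ k (k + 1) (ε / 2) 1)

/-- The character of the framing directions `δR_k` (weight `0`) and `δS_k` (weight `-λε` if `k = p`,
and `0` otherwise) at all the nodes. -/
def framingChar (ε : ℂ) (μ' μ : RectPattern n p lam) : ℂ →₀ ℤ :=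
  ∑ k ∈ Finset.Icc 1 (n - 1),
    ((∑ x : Atom μ k, Finsupp.single (phi ε μ k x) 1) +
      ∑ y : Atom μ' k, Finsupp.single (-phi ε μ' k y - if k = p then -(lam * ε) else 0) 1)

/-- The character of the complex that controls the homomorphisms `τ : V' → V`. -/
def pairChar (ε : ℂ) (μ' μ : RectPattern n p lam) : ℂ →₀ ℤ :=
  unframedChar ε μ' μ + framingChar ε μ' μ

/-- The character of the (regularised, that is, virtual) tangent space at the fixed point `μ`. -/
def tangentChar (ε : ℂ) (μ : RectPattern n p lam) : ℂ →₀ ℤ := pairChar ε μ μ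

/-- The character of the (virtual) tangent space to the incidence locus at `(μ, μ')`: the pairs of
deformations of `μ` and `μ'` along which the homomorphism `τ : V' → V` persists, where `V` is the
quotient of `V'` by the additional atom. -/
def incidenceChar (ε : ℂ) (μ μ' : RectPattern n p lam) : ℂ →₀ ℤ :=
  tangentChar ε μ + tangentChar ε μ' - pairChar ε μ' μ

/-- The regularised Euler class `(-1)^⌊#{zero weights}/2⌋ ∏_{w ≠ 0} w`. -/
def regEuler (χ : ℂ →₀ ℤ) : ℂ :=
  (-1) ^ (χ 0 / 2) * χ.prod fun w m => if w = 0 then 1 else w ^ m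

/-- The number of atoms, which is also the number of the directions `δS`. -/
def numAtoms (μ : RectPattern n p lam) : ℕ := ∑ k ∈ Finset.Icc 1 (n - 1), Fintype.card (Atom μ k)

/-- The Euler class of a fixed point. The sign means that the directions `δS` are
taken with the opposite orientation. -/
def eul (ε : ℂ) (μ : RectPattern n p lam) : ℂ :=
  (-1) ^ numAtoms μ * regEuler (tangentChar ε μ)

/-- The Euler class of the incidence locus of `μ` and `μ' = μ + □`; it contains as many directions
`δS` as there are atoms in `μ`, again with the opposite orientation. -/
def eulInc (ε : ℂ) (μ μ' : RectPattern n p lam) : ℂ :=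
  (-1) ^ numAtoms μ * regEuler (incidenceChar ε μ μ')

/-- The coefficient `E[μ → μ']`, where `μ' = μ + □`. -/
def coeffE (ε : ℂ) (μ μ' : RectPattern n p lam) : ℂ := eul ε μ / eulInc ε μ μ'

/-- The coefficient `F[μ' → μ]`, where `μ' = μ + □`. -/
def coeffF (ε : ℂ) (μ' μ : RectPattern n p lam) : ℂ := eul ε μ' / eulInc ε μ μ'

/-- The weight `l_{j,k} ε + a[k] ε - |k - p| ε/2` of the atom that is added to `μ` when `m_{j,k}`
is raised. -/
def addWeight (ε : ℂ) (k j : ℕ) (μ : RectPattern n p lam) : ℂ :=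
  (μ.l j k : ℂ) * ε + (aIdx p k : ℂ) * ε - ((|(k : ℤ) - p| : ℤ) : ℂ) * (ε / 2)

/-- The weight `(l_{j,k} - 1) ε + a[k] ε - |k - p| ε/2` of the atom that is removed from `μ` when
`m_{j,k}` is lowered. -/
def remWeight (ε : ℂ) (k j : ℕ) (μ : RectPattern n p lam) : ℂ :=
  ((μ.l j k : ℂ) - 1) * ε + (aIdx p k : ℂ) * ε - ((|(k : ℤ) - p| : ℤ) : ℂ) * (ε / 2)

/-- The mode `e^{(k)}_r`: the coefficient of `z^{-r-1}` in
`e^{(k)}(z) |μ⟩ = ∑_j E[μ → μ^j_{k,k+1}] / (z - φ) |μ^j_{k,k+1}⟩`, where `φ` is the weight of the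
additional atom. -/
def modeE (ε : ℂ) (k r : ℕ) :
    (RectPattern n p lam →₀ ℂ) →ₗ[ℂ] (RectPattern n p lam →₀ ℂ) :=
  raisingOp k (Finset.Icc (aIdx p k) (bIdx n p k))
    fun j μ μ' => coeffE ε μ μ' * addWeight ε k j μ ^ r

/-- The mode `f^{(k)}_r`: the coefficient of `z^{-r-1}` in
`f^{(k)}(z) |μ⟩ = ∑_j F[μ → μ^j_{k,k-1}] / (z - φ) |μ^j_{k,k-1}⟩`, where `φ` is the weight of the
removed atom. -/
def modeF (ε : ℂ) (k r : ℕ) :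
    (RectPattern n p lam →₀ ℂ) →ₗ[ℂ] (RectPattern n p lam →₀ ℂ) :=
  loweringOp k (Finset.Icc (aIdx p k) (bIdx n p k))
    fun j μ μ' => coeffF ε μ μ' * remWeight ε k j μ ^ r

/-- The change of basis that sends `|μ⟩` to `|μ⟩ / N(μ)`. -/
def rescale (N : RectPattern n p lam → ℂ) :
    (RectPattern n p lam →₀ ℂ) →ₗ[ℂ] (RectPattern n p lam →₀ ℂ) :=
  Finsupp.linearCombination ℂ fun μ => Finsupp.single μ (N μ)⁻¹

/-- A framing weight with the convention of the regularised Euler class: zero weights are left out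
of the products. -/
def nonzeroWeight (w : ℂ) : ℂ := if w = 0 then 1 else w

/-- The product formula for `E[μ → μ^j_{k,k+1}]`, `k ≠ p`. -/
def formulaE (ε : ℂ) (k j : ℕ) (μ : RectPattern n p lam) : ℂ :=
  ((∏ i ∈ Finset.Icc 1 j, ((μ.l i (k + 1) : ℂ) - μ.l j k)) *
      ∏ i ∈ Finset.Icc 1 (j - 1), ((μ.l i (k - 1) : ℂ) - μ.l j k - 1)) /
    (∏ i ∈ Finset.Icc 1 (j - 1),
      (((μ.l i k : ℂ) - μ.l j k) * ((μ.l i k : ℂ) - μ.l j k - 1))) *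
  (1 / nonzeroWeight (addWeight ε k j μ))

/-- The product formula for `F[μ → μ^j_{k,k-1}]`, `k ≠ p`. -/
def formulaF (ε : ℂ) (k j : ℕ) (μ : RectPattern n p lam) : ℂ :=
  ((-1) * (∏ i ∈ Finset.Icc (j + 1) (k + 1), ((μ.l i (k + 1) : ℂ) - μ.l j k + 1)) *
      ∏ i ∈ Finset.Icc j (k - 1), ((μ.l i (k - 1) : ℂ) - μ.l j k)) /
    (∏ i ∈ Finset.Icc (j + 1) k,
      (((μ.l i k : ℂ) - μ.l j k + 1) * ((μ.l i k : ℂ) - μ.l j k))) *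
  nonzeroWeight (remWeight ε k j μ)

/-- The product formula for `E[μ → μ^j_{p,p+1}]`. -/
def formulaEp (ε : ℂ) (j : ℕ) (μ : RectPattern n p lam) : ℂ :=
  -(((∏ i ∈ Finset.Icc 2 j, ((μ.l i (p + 1) : ℂ) - μ.l j p)) *
      ∏ i ∈ Finset.Icc 1 (j - 1), ((μ.l i (p - 1) : ℂ) - μ.l j p - 1)) /
    (∏ i ∈ Finset.Icc 1 (j - 1),
      (((μ.l i p : ℂ) - μ.l j p) * ((μ.l i p : ℂ) - μ.l j p - 1)))) *
  (1 / ε)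

/-- The product formula for `F[μ → μ^j_{p,p-1}]`. -/
def formulaFp (ε : ℂ) (j : ℕ) (μ : RectPattern n p lam) : ℂ :=
  (((μ.l 1 (p + 1) : ℂ) - μ.l j p + 1) *
      (∏ i ∈ Finset.Icc (j + 1) (p + 1), ((μ.l i (p + 1) : ℂ) - μ.l j p + 1)) *
      ∏ i ∈ Finset.Icc j (p - 1), ((μ.l i (p - 1) : ℂ) - μ.l j p)) /
    (∏ i ∈ Finset.Icc (j + 1) p,
      (((μ.l i p : ℂ) - μ.l j p + 1) * ((μ.l i p : ℂ) - μ.l j p))) *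
  ε

end

end RectYangian

end

noncomputable section

namespace RectYangian

section

namespace GTPattern

variable {n : ℕ} {top : ℕ → ℕ} (μ : GTPattern n top)

theorem m_mono {i k k' : ℕ} (hi : 1 ≤ i) (hik : i ≤ k) (hk : k ≤ k') (hn : k' ≤ n) :
    μ.m i k ≤ μ.m i k' := by
  induction k', hk using Nat.le_induction with
  | base => exact le_rfl
  | succ r hr ih => exact (ih (by omega)).trans (μ.left_ge i r hi (by omega) (by omega))

theorem m_diag {i k : ℕ} (hi : 1 ≤ i) (hik : i ≤ k) (d : ℕ) (hn : k + d ≤ n) :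
    μ.m (i + d) (k + d) ≤ μ.m i k := by
  induction d with
  | zero => exact le_rfl
  | succ d ih =>
    exact (μ.right_ge (i + d) (k + d) (by omega) (by omega) (by omega)).trans (ih (by omega))

theorem m_anti {i j k : ℕ} (hi : 1 ≤ i) (hij : i ≤ j) (hjk : j ≤ k) (hn : k ≤ n) :
    μ.m j k ≤ μ.m i k := by
  have h := μ.m_diag (i := i) (k := k - (j - i)) hi (by omega) (j - i) (by omega)
  rw [show i + (j - i) = j by omega, show k - (j - i) + (j - i) = k by omega] at h
  exact h.trans (μ.m_mono hi (by omega) (by omega) hn)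

end GTPattern

namespace IsRaise

variable {n : ℕ} {top : ℕ → ℕ} {μ μ' : GTPattern n top} {k j : ℕ}

theorem m_eq (h : IsRaise k j μ μ') : μ'.m j k = μ.m j k + 1 := by
  simp [h.2.2.2 j k]

theorem m_ne (h : IsRaise k j μ μ') {i r : ℕ} (hir : ¬(i = j ∧ r = k)) : μ'.m i r = μ.m i r := by
  rw [h.2.2.2 i r, if_neg hir]

theorem l_eq (h : IsRaise k j μ μ') : μ'.l j k = μ.l j k + 1 := by
  simp only [GTPattern.l, h.m_eq]; push_cast; ring

theorem l_ne (h : IsRaise k j μ μ') {i r : ℕ} (hir : ¬(i = j ∧ r = k)) : μ'.l i r = μ.l i r := by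
  simp only [GTPattern.l, h.m_ne hir]

theorem lt_above_left (h : IsRaise k j μ μ') {i : ℕ} (hi : 1 ≤ i) (hij : i ≤ j) :
    μ.l j k < μ.l i (k + 1) := by
  obtain ⟨h1, h2, h3, -⟩ := id h
  have e := μ'.m_mono h1 h2 (show k ≤ k + 1 by omega) h3
  rw [h.m_eq, h.m_ne (by omega)] at e
  have := μ.m_anti hi hij (show j ≤ k + 1 by omega) h3
  simp only [GTPattern.l]; omega

theorem above_right_lt (h : IsRaise k j μ μ') {i : ℕ} (hij : j < i) (hi : i ≤ k + 1) :
    μ.l i (k + 1) < μ.l j k := by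
  obtain ⟨h1, h2, h3, -⟩ := id h
  have e := μ.right_ge (i - 1) k (by omega) (by omega) h3
  rw [Nat.sub_add_cancel (by omega)] at e
  have := μ.m_anti h1 (show j ≤ i - 1 by omega) (show i - 1 ≤ k by omega) h3.le
  simp only [GTPattern.l]; omega

theorem lt_below_left (h : IsRaise k j μ μ') {i : ℕ} (hi : 1 ≤ i) (hij : i < j) :
    μ.l j k + 1 < μ.l i (k - 1) := by
  obtain ⟨h1, h2, h3, -⟩ := id h
  have e := μ'.right_ge i (k - 1) hi (by omega) (by omega)
  rw [Nat.sub_add_cancel (by omega)] at e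
  have e' := μ'.m_anti (show 1 ≤ i + 1 by omega) (show i + 1 ≤ j by omega) h2 h3.le
  rw [h.m_eq] at e'
  rw [h.m_ne (r := k - 1) (by omega)] at e
  simp only [GTPattern.l]; omega

theorem below_right_le (h : IsRaise k j μ μ') {i : ℕ} (hij : j ≤ i) (hi : i ≤ k - 1) :
    μ.l i (k - 1) ≤ μ.l j k := by
  obtain ⟨h1, h2, h3, -⟩ := id h
  have e := μ.m_mono (show 1 ≤ i by omega) hi (show k - 1 ≤ k by omega) h3.le
  have := μ.m_anti h1 hij (show i ≤ k by omega) h3.le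
  simp only [GTPattern.l]; omega

theorem lt_row_left (h : IsRaise k j μ μ') {i : ℕ} (hi : 1 ≤ i) (hij : i < j) :
    μ.l j k + 1 < μ.l i k := by
  obtain ⟨h1, h2, h3, -⟩ := id h
  have e' := μ'.m_anti hi hij.le h2 h3.le
  rw [h.m_eq, h.m_ne (by omega)] at e'
  simp only [GTPattern.l]; omega

theorem row_right_lt (h : IsRaise k j μ μ') {i : ℕ} (hij : j < i) (hi : i ≤ k) :
    μ.l i k < μ.l j k := by
  obtain ⟨h1, h2, h3, -⟩ := id h
  have := μ.m_anti h1 hij.le hi h3.le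
  simp only [GTPattern.l]; omega

end IsRaise

variable {n p lam : ℕ}

namespace RectPattern

theorem m_eq_lam (μ : RectPattern n p lam) {i k : ℕ} (hi : 1 ≤ i) (hik : i + p ≤ k) (hk : k ≤ n) :
    μ.m i k = lam := by
  have h1 := μ.m_mono hi (by omega) hk le_rfl
  have h2 := μ.m_diag hi (show i ≤ k by omega) (n - k) (by omega)
  rw [show k + (n - k) = n by omega, μ.top_row _ (by omega) (by omega)] at h2
  rw [μ.top_row _ (by omega) (by omega)] at h1
  simp only [rectTop] at h1 h2
  rw [if_pos (by omega)] at h1 h2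
  omega

theorem m_le_lam (μ : RectPattern n p lam) (i k : ℕ) : μ.m i k ≤ lam := by
  by_cases h : 1 ≤ i ∧ i ≤ k ∧ k ≤ n
  · have h1 := μ.m_mono h.1 h.2.1 h.2.2 le_rfl
    rw [μ.top_row _ (by omega) (by omega), rectTop] at h1
    split_ifs at h1 <;> omega
  · simp [μ.outside _ _ h]

theorem m_eq_zero (μ : RectPattern n p lam) {i : ℕ} (hi : n - p < i) (k : ℕ) : μ.m i k = 0 := by
  by_cases h : 1 ≤ i ∧ i ≤ k ∧ k ≤ n
  · have h1 := μ.m_mono h.1 h.2.1 h.2.2 le_rfl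
    rw [μ.top_row _ (by omega) (by omega), rectTop, if_neg (by omega)] at h1
    omega
  · exact μ.outside _ _ h

end RectPattern

theorem IsRaise.aIdx_le {μ μ' : RectPattern n p lam} {k j : ℕ} (h : IsRaise k j μ μ') :
    aIdx p k ≤ j := by
  obtain ⟨h1, h2, h3, -⟩ := id h
  by_contra hlt
  have : j + p ≤ k := by unfold aIdx at hlt; omega
  have e := h.m_eq
  rw [RectPattern.m_eq_lam μ h1 this h3.le, RectPattern.m_eq_lam μ' h1 this h3.le] at e
  omega

theorem IsRaise.le_bIdx {μ μ' : RectPattern n p lam} {k j : ℕ} (h : IsRaise k j μ μ') :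
    j ≤ bIdx n p k := by
  obtain ⟨h1, h2, h3, -⟩ := id h
  by_contra hlt
  have e := h.m_eq
  rw [RectPattern.m_eq_zero μ' (by unfold bIdx at hlt; omega)] at e
  omega

/-- Every pattern is obtained from the empty one by adding atoms one at a time. -/
theorem RectPattern.induction {P : RectPattern n p lam → Prop}
    (empty : ∀ μ : RectPattern n p lam,
      (∀ k i, k < n → aIdx p k ≤ i → μ.m i k = 0) → P μ)
    (step : ∀ μ μ' k j, IsRaise k j μ μ' → P μ → P μ') (μ : RectPattern n p lam) : P μ := by
  classical
  induction hN : ∑ k ∈ Finset.range n, ∑ i ∈ Finset.range n, μ.m i k using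
    Nat.strong_induction_on generalizing μ with
  | _ N ih =>
  by_cases h0 : ∀ k i, k < n → aIdx p k ≤ i → μ.m i k = 0
  · exact empty μ h0
  push Not at h0
  have : ∃ d, ∃ k i, k < n ∧ aIdx p k ≤ i ∧ μ.m i k ≠ 0 ∧ 2 * n - 2 * i + k = d := by
    obtain ⟨k, i, h1, h2, h3⟩ := h0
    exact ⟨_, k, i, h1, h2, h3, rfl⟩
  obtain ⟨k, j, hk, haj, hm, hd⟩ := Nat.find_spec this
  have hmin := fun d (hd : d < Nat.find this) => Nat.find_min this hd
  rw [← hd] at hmin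
  have hin : 1 ≤ j ∧ j ≤ k ∧ k ≤ n := by
    by_contra h; exact hm (μ.outside _ _ h)
  obtain ⟨h1, h2, -⟩ := hin
  have hb : j ≤ n - p := by
    by_contra h; exact hm (μ.m_eq_zero (by omega) _)
  have hbelow : j ≤ k - 1 → μ.m j (k - 1) < μ.m j k := by
    intro hj
    have hle := μ.m_mono h1 hj (Nat.sub_le k 1) hk.le
    refine lt_of_le_of_ne hle fun he => ?_
    exact hmin _ (by omega : 2 * n - 2 * j + (k - 1) < _)
      ⟨k - 1, j, by omega, by unfold aIdx at *; omega, by omega, rfl⟩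
  have hup : μ.m (j + 1) (k + 1) < μ.m j k := by
    have hle := μ.right_ge j k h1 h2 hk
    refine lt_of_le_of_ne hle fun he => ?_
    have hjb : j + 1 ≤ n - p := by
      by_contra h
      rw [μ.m_eq_zero (by omega)] at he
      exact hm he.symm
    exact hmin _ (by omega : 2 * n - 2 * (j + 1) + (k + 1) < _)
      ⟨k + 1, j + 1, by unfold aIdx at *; omega, by unfold aIdx at *; omega, by omega, rfl⟩
  let ν : RectPattern n p lam :=
    { m := fun i r => if i = j ∧ r = k then μ.m i r - 1 else μ.m i r
      top_row := fun i hi hi' => by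
        rw [if_neg (by omega)]; exact μ.top_row i hi hi'
      left_ge := fun i r hi hir hr => by
        have := μ.left_ge i r hi hir hr
        by_cases e : i = j ∧ r + 1 = k
        · obtain ⟨rfl, rfl⟩ := e
          have := hbelow (by omega)
          simp only [Nat.add_sub_cancel] at this
          rw [if_neg (by omega), if_pos (by omega)]; omega
        · rw [if_neg e]
          split_ifs <;> omega
      right_ge := fun i r hi hir hr => by
        have := μ.right_ge i r hi hir hr
        by_cases e : i = j ∧ r = k
        · obtain ⟨rfl, rfl⟩ := e
          rw [if_neg (by omega), if_pos (by omega)]; omega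
        · rw [if_neg e]
          split_ifs <;> omega
      outside := fun i r hir => by
        rw [μ.outside i r hir]; simp }
  have hν : IsRaise k j ν μ := by
    refine ⟨h1, h2, hk, fun i r => ?_⟩
    by_cases e : i = j ∧ r = k
    · obtain ⟨rfl, rfl⟩ := e
      simp [ν]; omega
    · simp [ν, e]
  refine step ν μ k j hν (ih _ ?_ ν rfl)
  rw [← hN]
  refine Finset.sum_lt_sum (fun r _ => Finset.sum_le_sum fun i _ => ?_)
    ⟨k, Finset.mem_range.2 hk, Finset.sum_lt_sum (fun i _ => ?_)
      ⟨j, Finset.mem_range.2 (by omega), ?_⟩⟩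
  · simp only [ν]; split_ifs <;> omega
  · simp only [ν]; split_ifs <;> omega
  · simp only [ν]; simp; omega

end

section

variable {n p lam : ℕ}

/-- The weight of the atom `(i, l)` of colour `k`, in units of `ε / 2`. -/
def atomWeight (p k i l : ℕ) : ℤ := 2 * ((l : ℤ) - i + 1) + k - p

theorem aIdx_cases (p k : ℕ) : (p ≤ k ∧ aIdx p k + p = k + 1) ∨ (k < p ∧ aIdx p k = 1) := by
  unfold aIdx; omega

theorem phi_eq (ε : ℂ) (μ : RectPattern n p lam) (k : ℕ) (x : Atom μ k) :
    phi ε μ k x = (atomWeight p k x.1 x.2 : ℂ) * (ε / 2) := by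
  unfold phi atomWeight
  rcases aIdx_cases p k with ⟨h1, h2⟩ | ⟨h1, h2⟩
  · rw [abs_of_nonneg (by omega)]
    have h2' : (aIdx p k : ℂ) = k + 1 - p := by rw [eq_sub_iff_add_eq]; exact_mod_cast h2
    rw [h2']; push_cast; ring
  · have h2' : (aIdx p k : ℂ) = 1 := by exact_mod_cast h2
    rw [abs_of_neg (by omega), h2']; push_cast; ring

theorem rCharge_eq (μ : RectPattern n p lam) (k : ℕ) (x : Atom μ k) :
    rCharge μ k x = 2 * ((x.1 : ℕ) : ℤ) - k + p - 2 := by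
  unfold rCharge
  rcases aIdx_cases p k with ⟨h1, h2⟩ | ⟨h1, h2⟩
  · rw [abs_of_nonneg (by omega)]; omega
  · rw [abs_of_neg (by omega)]; omega

theorem Atom.ext_iff {μ : RectPattern n p lam} {k : ℕ} {x y : Atom μ k} :
    x = y ↔ (x.1 : ℕ) = y.1 ∧ (x.2 : ℕ) = y.2 := by
  constructor
  · rintro rfl; exact ⟨rfl, rfl⟩
  · obtain ⟨⟨i, hi⟩, l, hl⟩ := x
    obtain ⟨⟨i', hi'⟩, l', hl'⟩ := y
    rintro ⟨rfl, rfl⟩; rfl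

theorem Atom.exists_iff (μ : RectPattern n p lam) (k : ℕ) (P : ℕ → ℕ → Prop) :
    (∃ z : Atom μ k, P z.1 z.2) ↔
      ∃ i l, aIdx p k ≤ i ∧ i ≤ bIdx n p k ∧ l < μ.m i k ∧ P i l := by
  constructor
  · rintro ⟨⟨⟨i, hi⟩, l, hl⟩, h⟩
    exact ⟨i, l, (Finset.mem_Icc.1 hi).1, (Finset.mem_Icc.1 hi).2, hl, h⟩
  · rintro ⟨i, l, h1, h2, h3, h⟩
    exact ⟨⟨⟨i, Finset.mem_Icc.2 ⟨h1, h2⟩⟩, l, h3⟩, h⟩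

theorem Atom.bounds {μ : RectPattern n p lam} {k : ℕ} (x : Atom μ k) :
    aIdx p k ≤ x.1 ∧ (x.1 : ℕ) ≤ bIdx n p k ∧ (x.2 : ℕ) < μ.m x.1 k :=
  ⟨(Finset.mem_Icc.1 x.1.2).1, (Finset.mem_Icc.1 x.1.2).2, x.2.2⟩

theorem Atom.lt_of_eq {μ : RectPattern n p lam} {k : ℕ} (x : Atom μ k) {i : ℕ}
    (h : (x.1 : ℕ) = i) : (x.2 : ℕ) < μ.m i k := by
  subst h; exact x.2.2

section Entries

variable (μ : RectPattern n p lam) (k : ℕ)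

theorem fixedPoint_C : (fixedPoint μ).C k = Matrix.of fun y x : Atom μ k =>
    if (y.1 : ℕ) = x.1 ∧ (y.2 : ℕ) = x.2 + 1 then 1 else 0 := by
  ext y x
  simp only [fixedPoint, blocks, matC, matO, Matrix.of_apply, ← Subtype.ext_iff]
  by_cases h : y.1 = x.1 <;> simp [h]

theorem fixedPoint_A : (fixedPoint μ).A k = Matrix.of fun (y : Atom μ (k + 1)) (x : Atom μ k) =>
    if (y.1 : ℕ) = x.1 + 1 ∧ (y.2 : ℕ) = x.2 then 1 else 0 := by
  ext y x
  simp only [fixedPoint, blocks, matI, matO, Matrix.of_apply]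
  by_cases h : (y.1 : ℕ) = x.1 + 1 <;> simp [h]

theorem fixedPoint_B : (fixedPoint μ).B k = Matrix.of fun (y : Atom μ k) (x : Atom μ (k + 1)) =>
    if (y.1 : ℕ) = x.1 ∧ (y.2 : ℕ) = x.2 then 1 else 0 := by
  ext y x
  simp only [fixedPoint, blocks, matI, matO, Matrix.of_apply]
  by_cases h : (y.1 : ℕ) = x.1 <;> simp [h]

theorem fixedPoint_R : (fixedPoint μ).R k = Matrix.of fun (y : Atom μ k) (_ : Fin 1) =>
    if k = p ∧ (y.1 : ℕ) = 1 ∧ (y.2 : ℕ) = 0 then 1 else 0 := by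
  ext y x
  fin_cases x
  simp only [fixedPoint, matI, matO, Matrix.of_apply]
  by_cases h : k = p ∧ (y.1 : ℕ) = 1
  · rw [if_pos h]; simp [h]
  · rw [if_neg h, if_neg (by tauto)]; simp

end Entries

theorem indicator_zero_or_one (P : Prop) [Decidable P] :
    ((if P then (1 : ℂ) else 0) = 0 ∨ (if P then (1 : ℂ) else 0) = 1) := by
  split_ifs <;> simp

theorem indicator_eq_one_iff (P : Prop) [Decidable P] :
    (if P then (1 : ℂ) else 0) = 1 ↔ P := by
  split_ifs with h <;> simp [h]

theorem int_weight_eq_iff {ε : ℂ} (hε : ε ≠ 0) (a b : ℤ) :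
    (a : ℂ) * (ε / 2) = b * (ε / 2) ↔ a = b := by
  rw [mul_left_inj' (by simpa using hε)]; exact_mod_cast Iff.rfl

theorem fixedPoint_isCrystal {ε : ℂ} (hε : ε ≠ 0)
    (μ : RectPattern n p lam) :
    (fixedPoint μ).IsCrystal n p lam ε (phi ε μ) (rCharge μ) := by
  refine ⟨fun k _ _ x y h => ?_, fun k _ _ x y => ?_, fun k _ _ x y => ?_, fun k _ _ x y => ?_,
    fun k _ _ y => ?_, fun k _ _ x => ?_⟩
  · simp only [Prod.mk.injEq, phi_eq, rCharge_eq, int_weight_eq_iff hε, atomWeight] at h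
    rw [Atom.ext_iff]; omega
  · rw [fixedPoint_C]
    refine ⟨indicator_zero_or_one _, (indicator_eq_one_iff _).trans ?_⟩
    rw [phi_eq, phi_eq, rCharge_eq, rCharge_eq,
      show (atomWeight p k x.1 x.2 : ℂ) * (ε / 2) + ε
        = ((atomWeight p k x.1 x.2 + 2 : ℤ) : ℂ) * (ε / 2) by push_cast; ring,
      int_weight_eq_iff hε]
    unfold atomWeight; omega
  · rw [fixedPoint_A]
    refine ⟨indicator_zero_or_one _, (indicator_eq_one_iff _).trans ?_⟩
    rw [phi_eq, phi_eq, rCharge_eq, rCharge_eq,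
      show (atomWeight p k x.1 x.2 : ℂ) * (ε / 2) - ε / 2
        = ((atomWeight p k x.1 x.2 - 1 : ℤ) : ℂ) * (ε / 2) by push_cast; ring,
      int_weight_eq_iff hε]
    unfold atomWeight; push_cast; omega
  · rw [fixedPoint_B]
    refine ⟨indicator_zero_or_one _, (indicator_eq_one_iff _).trans ?_⟩
    rw [phi_eq, phi_eq, rCharge_eq, rCharge_eq,
      show (atomWeight p (k + 1) x.1 x.2 : ℂ) * (ε / 2) - ε / 2
        = ((atomWeight p (k + 1) x.1 x.2 - 1 : ℤ) : ℂ) * (ε / 2) by push_cast; ring,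
      int_weight_eq_iff hε]
    unfold atomWeight; push_cast; omega
  · rw [fixedPoint_R]
    refine ⟨indicator_zero_or_one _, (indicator_eq_one_iff _).trans ?_⟩
    have hb := y.bounds
    rw [phi_eq, rCharge_eq, show (0 : ℂ) = ((0 : ℤ) : ℂ) * (ε / 2) by simp,
      int_weight_eq_iff hε]
    unfold atomWeight
    rcases aIdx_cases p k with ⟨h1, h2⟩ | ⟨h1, h2⟩ <;> omega
  · refine ⟨Or.inl rfl, iff_of_false (by simp [fixedPoint]) fun h => ?_⟩
    have hb := x.bounds
    have h2 := h.2
    rw [rCharge_eq] at h2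
    rcases aIdx_cases p k with ⟨h1, h2⟩ | ⟨h1, h2⟩ <;> omega

/-- The fixed-point equations hold for any matrices with the entries prescribed by the
positions. -/
theorem QuiverRep.IsCrystal.isFixed {ι : ℕ → Type} [∀ k, Fintype (ι k)] [∀ k, DecidableEq (ι k)]
    {q : QuiverRep ι} {ε : ℂ} {φ : ∀ k, ι k → ℂ} {R : ∀ k, ι k → ℤ}
    (hp : 1 ≤ p) (hpn : p < n) (h : q.IsCrystal n p lam ε φ R) :
    q.IsFixed n p lam ε φ := by
  obtain ⟨-, hC, hA, hB, hR, hS⟩ := h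
  refine ⟨fun k h1 h2 => ?_, fun k h1 h2 => ?_, fun k h1 h2 => ?_, fun k h1 h2 => ?_, ?_⟩
  · ext y x
    obtain ⟨h0 | h0, h'⟩ := hC k h1 h2 x y
    · simp [h0]
    · simp [h0, (h'.1 h0).1]
  · ext y x
    obtain ⟨h0 | h0, h'⟩ := hA k h1 h2 x y
    · simp [h0]
    · simp [h0, (h'.1 h0).1]; ring
  · ext y x
    obtain ⟨h0 | h0, h'⟩ := hB k h1 h2 x y
    · simp [h0]
    · simp [h0, (h'.1 h0).1]; ring
  · ext y x
    fin_cases x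
    obtain ⟨h0 | h0, h'⟩ := hR k h1 h2 y
    · simp [h0]
    · simp [h0, (h'.1 h0).1]
  · ext y x
    fin_cases y
    obtain ⟨h0 | h0, h'⟩ := hS p hp (by omega) x
    · simp [h0]
    · have := (h'.1 h0).1
      simp only [if_true] at this
      simp [h0]; linear_combination -this

/-- The product of two matrices of partial maps. -/
theorem indicator_mul {α β γ : Type} [Fintype β] (P : α → β → Prop) (Q : β → γ → Prop)
    [∀ a b, Decidable (P a b)] [∀ b c, Decidable (Q b c)]
    (hQ : ∀ b b' c, Q b c → Q b' c → b = b') (a : α) (c : γ) [Decidable (∃ b, P a b ∧ Q b c)] :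
    ((Matrix.of fun a b => if P a b then (1 : ℂ) else 0) *
      (Matrix.of fun b c => if Q b c then (1 : ℂ) else 0)) a c
      = if ∃ b, P a b ∧ Q b c then 1 else 0 := by
  classical
  simp only [Matrix.mul_apply, Matrix.of_apply, ← ite_and, ite_mul, one_mul, zero_mul]
  split_ifs with h
  · obtain ⟨b, hb⟩ := h
    rw [Finset.sum_eq_single b, if_pos hb]
    · intro b' _ hne
      exact if_neg fun hb' => hne (hQ _ _ _ hb'.2 hb.2)
    · simp
  · exact Finset.sum_eq_zero fun b _ => if_neg fun hb => h ⟨b, hb⟩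

theorem indicator_mul_ext {α β β' γ : Type} [Fintype β] [Fintype β']
    {P : α → β → Prop} {Q : β → γ → Prop} {P' : α → β' → Prop} {Q' : β' → γ → Prop}
    [∀ a b, Decidable (P a b)] [∀ b c, Decidable (Q b c)]
    [∀ a b, Decidable (P' a b)] [∀ b c, Decidable (Q' b c)]
    (hQ : ∀ b b' c, Q b c → Q b' c → b = b') (hQ' : ∀ b b' c, Q' b c → Q' b' c → b = b')
    (h : ∀ a c, (∃ b, P a b ∧ Q b c) ↔ ∃ b, P' a b ∧ Q' b c) :
    (Matrix.of fun a b => if P a b then (1 : ℂ) else 0) *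
      (Matrix.of fun b c => if Q b c then (1 : ℂ) else 0) =
    (Matrix.of fun a b => if P' a b then (1 : ℂ) else 0) *
      (Matrix.of fun b c => if Q' b c then (1 : ℂ) else 0) := by
  classical
  ext a c
  rw [indicator_mul P Q hQ, indicator_mul P' Q' hQ']
  simp only [h]

theorem indicator_mul_eq_zero {α β γ : Type} [Fintype β]
    {P : α → β → Prop} {Q : β → γ → Prop}
    [∀ a b, Decidable (P a b)] [∀ b c, Decidable (Q b c)]
    (hQ : ∀ b b' c, Q b c → Q b' c → b = b') (h : ∀ a b c, P a b → Q b c → False) :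
    (Matrix.of fun a b => if P a b then (1 : ℂ) else 0) *
      (Matrix.of fun b c => if Q b c then (1 : ℂ) else 0) = 0 := by
  classical
  ext a c
  rw [indicator_mul P Q hQ, if_neg]
  · rfl
  · rintro ⟨b, h1, h2⟩
    exact h a b c h1 h2

theorem fixedPoint_C_pow_mul_R (μ : RectPattern n p lam) (s : ℕ) :
    (fixedPoint μ).C p ^ s * (fixedPoint μ).R p =
      Matrix.of fun (y : Atom μ p) (_ : Fin 1) =>
        if (y.1 : ℕ) = 1 ∧ (y.2 : ℕ) = s then 1 else 0 := by
  classical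
  induction s with
  | zero => simp [fixedPoint_R]
  | succ s ih =>
    rw [pow_succ', Matrix.mul_assoc, ih, fixedPoint_C]
    ext y x
    rw [indicator_mul (fun y x : Atom μ p => (y.1 : ℕ) = x.1 ∧ (y.2 : ℕ) = x.2 + 1)
      (fun (y : Atom μ p) (_ : Fin 1) => (y.1 : ℕ) = 1 ∧ (y.2 : ℕ) = s)]
    · simp only [Matrix.of_apply]
      congr 1
      rw [Atom.exists_iff μ p fun i l => ((y.1 : ℕ) = i ∧ (y.2 : ℕ) = l + 1) ∧ i = 1 ∧ l = s,
        eq_iff_iff]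
      have := y.bounds
      constructor
      · rintro ⟨i, l, h1, h2, h3, h⟩; omega
      · intro h
        exact ⟨y.1, s, by omega, by omega, by omega, by omega⟩
    · intro b b' c h h'; rw [Atom.ext_iff]; omega

theorem fixedPoint_fTerms (hp : 1 ≤ p) (hpn : p < n) (μ : RectPattern n p lam) :
    (fixedPoint μ).FTerms n p lam := by
  refine ⟨fun k h1 h2 => ?_, fun k h1 h2 => ?_, fun k h1 h2 => ?_, fun hn => ?_, fun hn => ?_, ?_,
    fun k _ _ => rfl⟩
  · rw [fixedPoint_C, fixedPoint_B, fixedPoint_C]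
    refine indicator_mul_ext (fun b b' c h h' => by rw [Atom.ext_iff]; omega)
      (fun b b' c h h' => by rw [Atom.ext_iff]; omega) fun y x => ?_
    rw [Atom.exists_iff μ k fun i l => ((y.1 : ℕ) = i ∧ (y.2 : ℕ) = l + 1) ∧ i = x.1 ∧ l = x.2,
      Atom.exists_iff μ (k + 1) fun i l => ((y.1 : ℕ) = i ∧ (y.2 : ℕ) = l) ∧ i = x.1 ∧ l = x.2 + 1]
    have hx := x.bounds
    have hy := y.bounds
    have ha : 1 ≤ aIdx p k := by unfold aIdx; omega
    have hb : bIdx n p k ≤ k := by unfold bIdx; omega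
    have := μ.left_ge y.1 k (by omega) (by omega) (by omega)
    constructor
    · rintro ⟨i, l, -, -, -, h⟩
      exact ⟨y.1, y.2, by omega, by omega, by omega, by omega⟩
    · rintro ⟨i, l, -, -, -, h⟩
      exact ⟨y.1, x.2, by omega, by omega, by omega, by omega⟩
  · rw [fixedPoint_C, fixedPoint_A, fixedPoint_C]
    refine indicator_mul_ext (fun b b' c h h' => by rw [Atom.ext_iff]; omega)
      (fun b b' c h h' => by rw [Atom.ext_iff]; omega) fun y x => ?_
    rw [Atom.exists_iff μ k fun i l =>
        ((y.1 : ℕ) = i + 1 ∧ (y.2 : ℕ) = l) ∧ i = x.1 ∧ l = x.2 + 1,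
      Atom.exists_iff μ (k + 1) fun i l =>
        ((y.1 : ℕ) = i ∧ (y.2 : ℕ) = l + 1) ∧ i = x.1 + 1 ∧ l = x.2]
    have hx := x.bounds
    have hy := y.bounds
    have ha : 1 ≤ aIdx p k := by unfold aIdx; omega
    have hb : bIdx n p k ≤ k := by unfold bIdx; omega
    have := μ.right_ge x.1 k (by omega) (by omega) (by omega)
    constructor
    · rintro ⟨i, l, -, -, -, h⟩
      exact ⟨y.1, x.2, by omega, by omega, by omega, by omega⟩
    · rintro ⟨i, l, -, -, -, h⟩
      have e : (y.1 : ℕ) = x.1 + 1 := by omega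
      have hy' := y.lt_of_eq e
      exact ⟨x.1, y.2, by omega, by omega, by omega, by omega⟩
  · rw [fixedPoint_A, fixedPoint_B, fixedPoint_A, fixedPoint_B]
    refine indicator_mul_ext (fun b b' c h h' => by rw [Atom.ext_iff]; omega)
      (fun b b' c h h' => by rw [Atom.ext_iff]; omega) fun y x => ?_
    rw [Atom.exists_iff μ (k + 2) fun i l =>
        ((y.1 : ℕ) = i ∧ (y.2 : ℕ) = l) ∧ i = x.1 + 1 ∧ l = x.2,
      Atom.exists_iff μ k fun i l =>
        ((y.1 : ℕ) = i + 1 ∧ (y.2 : ℕ) = l) ∧ i = x.1 ∧ l = x.2]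
    have hx := x.bounds
    have hy := y.bounds
    have ha : 1 ≤ aIdx p k ∧ aIdx p k ≤ aIdx p (k + 1) ∧ aIdx p (k + 2) ≤ aIdx p (k + 1) + 1 := by
      unfold aIdx; omega
    have hb : bIdx n p (k + 1) ≤ k + 1 ∧ bIdx n p (k + 1) ≤ bIdx n p (k + 2) ∧
      bIdx n p (k + 1) ≤ bIdx n p k + 1 := by unfold bIdx; omega
    constructor
    · rintro ⟨i, l, -, -, -, h⟩
      have e : (y.1 : ℕ) = x.1 + 1 := by omega
      have hy' := y.lt_of_eq e
      have := μ.right_ge x.1 k (by omega) (by omega) (by omega)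
      exact ⟨x.1, y.2, by omega, by omega, by omega, by omega⟩
    · rintro ⟨i, l, -, -, -, h⟩
      have : μ.m y.1 (k + 1) ≤ μ.m y.1 (k + 2) :=
        μ.left_ge y.1 (k + 1) (by omega) (by omega) (by omega)
      exact ⟨y.1, y.2, by omega, by omega, by omega, by omega⟩
  · rw [fixedPoint_A, fixedPoint_B]
    refine indicator_mul_eq_zero (fun b b' c h h' => by rw [Atom.ext_iff]; omega)
      fun y b x h h' => ?_
    have hx := x.bounds
    have hy := y.bounds
    have ha : 1 ≤ aIdx p 1 := by unfold aIdx; omega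
    have hb : bIdx n p 1 ≤ 1 := by unfold bIdx; omega
    omega
  · rw [fixedPoint_A, fixedPoint_B]
    refine indicator_mul_eq_zero (fun b b' c h h' => by rw [Atom.ext_iff]; omega)
      fun y b x h h' => ?_
    have hx := x.bounds
    have hy := y.bounds
    have ha : n - p ≤ aIdx p (n - 2 + 1) := by unfold aIdx; omega
    have hb : bIdx n p (n - 2 + 1) ≤ n - p := by unfold bIdx; omega
    omega
  · rw [fixedPoint_C_pow_mul_R]
    ext y x
    have h1 := y.bounds
    have h2 := μ.m_le_lam y.1 p
    simp only [Matrix.of_apply, Matrix.zero_apply]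
    rw [if_neg (by omega)]

end

section

variable {n p lam : ℕ}

theorem mulVec_single_of_indicator {α β : Type} [Fintype β] [DecidableEq α] [DecidableEq β]
    {P : α → β → Prop} [∀ a b, Decidable (P a b)] {a : α} {b : β}
    (h : ∀ a', P a' b ↔ a' = a) :
    (Matrix.of fun a b => if P a b then (1 : ℂ) else 0) *ᵥ Pi.single b 1 = Pi.single a 1 := by
  ext a'
  simp [Pi.single_apply, h]

theorem pathVec_first (hpn : p < n) (μ : RectPattern n p lam) (r : ℕ) :
    ∀ (k : ℕ) (x : Atom μ k), 1 ≤ k → k ≤ n - 1 → 2 * (x.1 : ℕ) + p - k - 2 = r →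
      (x.2 : ℕ) = 0 → (fixedPoint μ).PathVec n p k (Pi.single x 1) := by
  induction r using Nat.strong_induction_on with
  | _ r ih =>
  intro k x h1 h2 hr h0
  have hx := x.bounds
  have hk : (x.1 : ℕ) ≤ k := by unfold bIdx at hx; omega
  have ha : 1 ≤ aIdx p k := by unfold aIdx; omega
  by_cases hroot : k = p ∧ (x.1 : ℕ) = 1
  · obtain ⟨rfl, hx1⟩ := hroot
    have e : (fun y => (fixedPoint μ).R k y 0) = Pi.single x 1 := by
      ext y
      rw [fixedPoint_R]
      simp only [Matrix.of_apply, Pi.single_apply, Atom.ext_iff]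
      simp only [hx1, h0, true_and]
    rw [← e]
    exact .root
  by_cases hkp : k < p
  · have := μ.left_ge x.1 k (by omega) hk (by omega)
    let z : Atom μ (k + 1) := ⟨⟨x.1, Finset.mem_Icc.2 (by unfold aIdx bIdx at *; omega)⟩, 0,
      by change 0 < μ.m x.1 (k + 1); omega⟩
    have hz1 : (z.1 : ℕ) = x.1 := rfl
    have hz2 : (z.2 : ℕ) = 0 := rfl
    have hz := ih _ (by omega : 2 * (z.1 : ℕ) + p - (k + 1) - 2 < r) (k + 1) z (by omega)
      (by omega) rfl hz2
    have := QuiverRep.PathVec.stepB k _ h1 (by omega) hz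
    rwa [fixedPoint_B, mulVec_single_of_indicator (a := x)] at this
    intro a'; simp only [Atom.ext_iff, h0, hz1, hz2]
  · have hx1 : 2 ≤ (x.1 : ℕ) ∧ aIdx p (k - 1) + 1 ≤ x.1 := by
      unfold aIdx at *; omega
    obtain ⟨k, rfl⟩ : ∃ k', k = k' + 1 := ⟨k - 1, by omega⟩
    obtain ⟨i, hi⟩ : ∃ i, (x.1 : ℕ) = i + 1 := ⟨x.1 - 1, by omega⟩
    have := μ.right_ge i k (by omega) (by omega) (by omega)
    have := x.lt_of_eq hi
    have hak : k + 1 ≤ p + aIdx p k := by unfold aIdx; omega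
    simp only [Nat.add_sub_cancel] at hx1
    let z : Atom μ k := ⟨⟨i, Finset.mem_Icc.2 (by unfold bIdx at *; omega)⟩, 0,
      by change 0 < μ.m i k; omega⟩
    have hz1 : (z.1 : ℕ) = i := rfl
    have hz2 : (z.2 : ℕ) = 0 := rfl
    have hz := ih _ (by omega : 2 * (z.1 : ℕ) + p - k - 2 < r) k z (by omega)
      (by omega) rfl hz2
    have := QuiverRep.PathVec.stepA k _ (by omega) (by omega) hz
    rwa [fixedPoint_A, mulVec_single_of_indicator (a := x)] at this
    intro a'; simp only [Atom.ext_iff, h0, hz1, hz2, hi]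

theorem pathVec_single (hpn : p < n) (μ : RectPattern n p lam) {k : ℕ} (h1 : 1 ≤ k) (h2 : k ≤ n - 1) (l : ℕ) :
    ∀ x : Atom μ k, (x.2 : ℕ) = l → (fixedPoint μ).PathVec n p k (Pi.single x 1) := by
  induction l with
  | zero => exact fun x h => pathVec_first hpn μ _ k x h1 h2 rfl h
  | succ l ih =>
    intro x h
    let z : Atom μ k := ⟨x.1, l, by have := x.2.2; omega⟩
    have := QuiverRep.PathVec.stepC k _ (ih z rfl)
    rwa [fixedPoint_C, mulVec_single_of_indicator (a := x)] at this
    intro a'; rw [Atom.ext_iff, h]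

theorem fixedPoint_isCyclic (hpn : p < n) (μ : RectPattern n p lam) : (fixedPoint μ).IsCyclic n p := by
  intro k h1 h2
  rw [eq_top_iff, ← (Pi.basisFun ℂ (Atom μ k)).span_eq]
  refine Submodule.span_mono ?_
  rintro _ ⟨x, rfl⟩
  rw [Pi.basisFun_apply]
  exact pathVec_single hpn μ h1 h2 _ x rfl

end

section

variable {n p lam : ℕ}

section Sums

@[to_additive]
theorem prod_atom {M : Type*} [CommMonoid M] (μ : RectPattern n p lam) (k : ℕ)
    (g : ℕ → ℕ → M) :
    ∏ x : Atom μ k, g x.1 x.2 =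
      ∏ i ∈ Finset.Icc (aIdx p k) (bIdx n p k), ∏ l ∈ Finset.range (μ.m i k), g i l := by
  rw [Fintype.prod_sigma, ← Finset.prod_coe_sort (Finset.Icc (aIdx p k) (bIdx n p k))
    fun i => ∏ l ∈ Finset.range (μ.m i k), g i l]
  exact Finset.prod_congr rfl fun i _ => Fin.prod_univ_eq_prod_range (fun l => g i l) _

@[to_additive]
theorem IsRaise.prod_atom_eq {M : Type*} [CommMonoid M] {μ μ' : RectPattern n p lam} {k j : ℕ}
    (h : IsRaise k j μ μ') (t : ℕ) (g : ℕ → ℕ → M) :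
    ∏ x : Atom μ' t, g x.1 x.2 =
      (∏ x : Atom μ t, g x.1 x.2) * if t = k then g j (μ.m j k) else 1 := by
  rw [prod_atom μ', prod_atom μ]
  by_cases ht : t = k
  · subst ht
    have hj : j ∈ Finset.Icc (aIdx p t) (bIdx n p t) := Finset.mem_Icc.2 ⟨h.aIdx_le, h.le_bIdx⟩
    rw [if_pos rfl, ← Finset.mul_prod_erase _ _ hj, ← Finset.mul_prod_erase _ _ hj, h.m_eq,
      Finset.prod_range_succ, mul_assoc, mul_assoc, mul_comm (g j _)]
    congr 2
    refine Finset.prod_congr rfl fun i hi => ?_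
    rw [h.m_ne fun e => (Finset.mem_erase.1 hi).1 e.1]
  · rw [if_neg ht, mul_one]
    refine Finset.prod_congr rfl fun i _ => ?_
    rw [h.m_ne fun e => ht e.2]

variable {M : Type*} [AddCommMonoid M]

theorem sum_Icc_ite_le (g : ℕ → M) {a b J : ℕ} (hJ : J ≤ b) :
    (∑ i ∈ Finset.Icc a b, if i ≤ J then g i else 0) = ∑ i ∈ Finset.Icc a J, g i := by
  rw [← Finset.sum_filter]
  congr 1; ext i; simp only [Finset.mem_filter, Finset.mem_Icc]; omega

theorem sum_Icc_ite_ge (g : ℕ → M) {a b J s : ℕ} (hJ : a ≤ J) (hs : b ≤ s)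
    (hg : ∀ i, b < i → i ≤ s → g i = 0) :
    (∑ i ∈ Finset.Icc a b, if J ≤ i then g i else 0) = ∑ i ∈ Finset.Icc J s, g i := by
  rw [← Finset.sum_filter]
  refine Finset.sum_subset (fun i hi => ?_) fun i hi hi' => hg i ?_ ?_
  all_goals
    simp only [Finset.mem_filter, Finset.mem_Icc] at *
    omega

theorem sum_Icc_one_split (g : ℕ → M) {a J : ℕ} (h1 : 1 ≤ a) (hJ : a ≤ J + 1) :
    ∑ i ∈ Finset.Icc 1 J, g i =
      (∑ i ∈ Finset.Icc 1 (a - 1), g i) + ∑ i ∈ Finset.Icc a J, g i := by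
  rw [← Finset.sum_union]
  · congr 1; ext i; simp only [Finset.mem_union, Finset.mem_Icc]; omega
  · rw [Finset.disjoint_left]; intro i; simp only [Finset.mem_Icc]; omega

end Sums

/-- The character of one dimension of weight `w ε / 2`. -/
def halfChar (ε : ℂ) (w : ℤ) : ℂ →₀ ℤ := Finsupp.single (w * (ε / 2)) 1

/-- The character of one dimension of weight `w ε`. -/
def intChar (ε : ℂ) (w : ℤ) : ℂ →₀ ℤ := Finsupp.single (w * ε) 1

theorem halfChar_eq (ε : ℂ) {w v : ℤ} (h : w = 2 * v) : halfChar ε w = intChar ε v := by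
  subst h; unfold halfChar intChar; congr 1; push_cast; ring

/-- The contribution of the atoms `(i', l')` of colour `s` and `(i, l)` of colour `t` to the
character of an arrow `s → t` of weight `h ε / 2` and R-charge `r`. -/
def homTerm (ε : ℂ) (p s t : ℕ) (h r : ℤ) (i' l' i l : ℕ) : ℂ →₀ ℤ :=
  if 0 ≤ 2 * ((i : ℤ) - i') - t + s - r then
    halfChar ε (atomWeight p t i l - atomWeight p s i' l' - h) else 0

theorem homChar_eq (ε : ℂ) (μ' μ : RectPattern n p lam) (s t : ℕ) {h : ℂ} {w : ℤ} (r : ℤ)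
    (hw : h = w * (ε / 2)) :
    homChar ε μ' μ s t h r =
      ∑ y : Atom μ' s, ∑ x : Atom μ t, homTerm ε p s t w r y.1 y.2 x.1 x.2 := by
  unfold homChar homTerm halfChar
  refine Finset.sum_congr rfl fun y _ => Finset.sum_congr rfl fun x _ => ?_
  rw [rCharge_eq, rCharge_eq, phi_eq, phi_eq, hw]
  refine if_congr (by constructor <;> intro <;> omega) ?_ rfl
  congr 1; push_cast; ring

/-- The contribution of a pair of atoms of the same colour to the unframed complex. -/
def loopTerm (ε : ℂ) (p s : ℕ) (i' l' i l : ℕ) : ℂ →₀ ℤ :=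
  homTerm ε p s s 2 0 i' l' i l - homTerm ε p s s 0 0 i' l' i l
    - homTerm ε p s s (-2) 2 i' l' i l + homTerm ε p s s 0 2 i' l' i l

/-- The contribution of a pair of atoms of neighbouring colours to the unframed complex. -/
def edgeTerm (ε : ℂ) (p s t : ℕ) (i' l' i l : ℕ) : ℂ →₀ ℤ :=
  homTerm ε p s t (-1) 1 i' l' i l - homTerm ε p s t 1 1 i' l' i l

theorem unframedChar_eq (ε : ℂ) (μ' μ : RectPattern n p lam) :
    unframedChar ε μ' μ =
      (∑ k ∈ Finset.Icc 1 (n - 1), ∑ y : Atom μ' k, ∑ x : Atom μ k,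
        loopTerm ε p k y.1 y.2 x.1 x.2) +
      ((∑ k ∈ Finset.Icc 1 (n - 2), ∑ y : Atom μ' k, ∑ x : Atom μ (k + 1),
        edgeTerm ε p k (k + 1) y.1 y.2 x.1 x.2) +
      ∑ k ∈ Finset.Icc 1 (n - 2), ∑ y : Atom μ' (k + 1), ∑ x : Atom μ k,
        edgeTerm ε p (k + 1) k y.1 y.2 x.1 x.2) := by
  unfold unframedChar
  rw [← Finset.sum_add_distrib (s := Finset.Icc 1 (n - 2))]
  congr 1
  · refine Finset.sum_congr rfl fun k _ => ?_
    rw [homChar_eq ε μ' μ k k (w := 2) 0 (by push_cast; ring),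
      homChar_eq ε μ' μ k k (w := 0) 0 (by push_cast; ring),
      homChar_eq ε μ' μ k k (w := -2) 2 (by push_cast; ring),
      homChar_eq ε μ' μ k k (w := 0) 2 (by push_cast; ring)]
    simp only [loopTerm, Finset.sum_add_distrib, Finset.sum_sub_distrib]
  · refine Finset.sum_congr rfl fun k _ => ?_
    rw [homChar_eq ε μ' μ k (k + 1) (w := -1) 1 (by push_cast; ring),
      homChar_eq ε μ' μ (k + 1) k (w := -1) 1 (by push_cast; ring),
      homChar_eq ε μ' μ (k + 1) k (w := 1) 1 (by push_cast; ring),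
      homChar_eq ε μ' μ k (k + 1) (w := 1) 1 (by push_cast; ring)]
    simp only [edgeTerm, Finset.sum_sub_distrib]
    abel

section TwoNodes

variable {M : Type*} [AddCommMonoid M] {μ μ' : RectPattern n p lam} {k j : ℕ}

theorem IsRaise.sum_atom_target (h : IsRaise k j μ μ') (ν : RectPattern n p lam) (s t : ℕ)
    (g : ℕ → ℕ → ℕ → ℕ → M) :
    ∑ y : Atom ν s, ∑ x : Atom μ' t, g y.1 y.2 x.1 x.2 =
      (∑ y : Atom ν s, ∑ x : Atom μ t, g y.1 y.2 x.1 x.2) +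
        if t = k then ∑ y : Atom ν s, g y.1 y.2 j (μ.m j k) else 0 := by
  rw [Finset.sum_congr rfl fun y _ => h.sum_atom_eq t (g y.1 y.2), Finset.sum_add_distrib]
  congr 1
  split_ifs <;> simp

theorem IsRaise.sum_atom_source (h : IsRaise k j μ μ') (ν : RectPattern n p lam) (s t : ℕ)
    (g : ℕ → ℕ → ℕ → ℕ → M) :
    ∑ y : Atom μ' s, ∑ x : Atom ν t, g y.1 y.2 x.1 x.2 =
      (∑ y : Atom μ s, ∑ x : Atom ν t, g y.1 y.2 x.1 x.2) +
        if s = k then ∑ x : Atom ν t, g j (μ.m j k) x.1 x.2 else 0 :=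
  h.sum_atom_eq s fun i' l' => ∑ x : Atom ν t, g i' l' x.1 x.2

theorem sum_atom_outside (μ : RectPattern n p lam) (hk : k = 0 ∨ n ≤ k) (g : ℕ → ℕ → M) :
    ∑ x : Atom μ k, g x.1 x.2 = 0 := by
  rw [sum_atom, Finset.Icc_eq_empty, Finset.sum_empty]
  unfold aIdx bIdx; omega

theorem IsRaise.unframedChar_target (ε : ℂ) (h : IsRaise k j μ μ') (ν : RectPattern n p lam) :
    unframedChar ε ν μ' = unframedChar ε ν μ +
      ((∑ y : Atom ν k, loopTerm ε p k y.1 y.2 j (μ.m j k)) +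
        ((∑ y : Atom ν (k - 1), edgeTerm ε p (k - 1) k y.1 y.2 j (μ.m j k)) +
          ∑ y : Atom ν (k + 1), edgeTerm ε p (k + 1) k y.1 y.2 j (μ.m j k))) := by
  obtain ⟨h1, h2, h3, -⟩ := id h
  rw [unframedChar_eq, unframedChar_eq]
  rw [Finset.sum_congr rfl fun s _ => h.sum_atom_target ν s s (loopTerm ε p s),
    Finset.sum_congr rfl fun s _ => h.sum_atom_target ν s (s + 1) (edgeTerm ε p s (s + 1)),
    Finset.sum_congr rfl fun s _ => h.sum_atom_target ν (s + 1) s (edgeTerm ε p (s + 1) s)]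
  simp only [Finset.sum_add_distrib]
  have e1 : (∑ s ∈ Finset.Icc 1 (n - 1), if s = k then
      ∑ y : Atom ν s, loopTerm ε p s y.1 y.2 j (μ.m j k) else 0) =
      ∑ y : Atom ν k, loopTerm ε p k y.1 y.2 j (μ.m j k) := by
    rw [Finset.sum_ite_eq' (Finset.Icc 1 (n - 1)) k fun s =>
      ∑ y : Atom ν s, loopTerm ε p s y.1 y.2 j (μ.m j k),
      if_pos (Finset.mem_Icc.2 (by omega))]
  have e2 : (∑ s ∈ Finset.Icc 1 (n - 2), if s + 1 = k then
      ∑ y : Atom ν s, edgeTerm ε p s (s + 1) y.1 y.2 j (μ.m j k) else 0) =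
      ∑ y : Atom ν (k - 1), edgeTerm ε p (k - 1) k y.1 y.2 j (μ.m j k) := by
    obtain ⟨k, rfl⟩ : ∃ r, k = r + 1 := ⟨k - 1, by omega⟩
    simp only [Nat.add_right_cancel_iff, Nat.add_sub_cancel]
    rw [Finset.sum_ite_eq' (Finset.Icc 1 (n - 2)) k fun s =>
      ∑ y : Atom ν s, edgeTerm ε p s (s + 1) y.1 y.2 j (μ.m j (k + 1))]
    split_ifs with hk
    · rfl
    · exact (sum_atom_outside ν (k := k) (by rw [Finset.mem_Icc] at hk; omega) fun i l =>
        edgeTerm ε p k (k + 1) i l j (μ.m j (k + 1))).symm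
  have e3 : (∑ s ∈ Finset.Icc 1 (n - 2), if s = k then
      ∑ y : Atom ν (s + 1), edgeTerm ε p (s + 1) s y.1 y.2 j (μ.m j k) else 0) =
      ∑ y : Atom ν (k + 1), edgeTerm ε p (k + 1) k y.1 y.2 j (μ.m j k) := by
    rw [Finset.sum_ite_eq' (Finset.Icc 1 (n - 2)) k fun s =>
      ∑ y : Atom ν (s + 1), edgeTerm ε p (s + 1) s y.1 y.2 j (μ.m j k)]
    split_ifs with hk
    · rfl
    · rw [sum_atom_outside ν (k := k + 1) (by rw [Finset.mem_Icc] at hk; omega) fun i l =>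
        edgeTerm ε p (k + 1) k i l j (μ.m j k)]
  rw [e1, e2, e3]
  abel

theorem IsRaise.unframedChar_source (ε : ℂ) (h : IsRaise k j μ μ') (ν : RectPattern n p lam) :
    unframedChar ε μ' ν = unframedChar ε μ ν +
      ((∑ x : Atom ν k, loopTerm ε p k j (μ.m j k) x.1 x.2) +
        ((∑ x : Atom ν (k + 1), edgeTerm ε p k (k + 1) j (μ.m j k) x.1 x.2) +
          ∑ x : Atom ν (k - 1), edgeTerm ε p k (k - 1) j (μ.m j k) x.1 x.2)) := by
  obtain ⟨h1, h2, h3, -⟩ := id h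
  rw [unframedChar_eq, unframedChar_eq]
  rw [Finset.sum_congr rfl fun s _ => h.sum_atom_source ν s s (loopTerm ε p s),
    Finset.sum_congr rfl fun s _ => h.sum_atom_source ν s (s + 1) (edgeTerm ε p s (s + 1)),
    Finset.sum_congr rfl fun s _ => h.sum_atom_source ν (s + 1) s (edgeTerm ε p (s + 1) s)]
  simp only [Finset.sum_add_distrib]
  have e1 : (∑ s ∈ Finset.Icc 1 (n - 1), if s = k then
      ∑ x : Atom ν s, loopTerm ε p s j (μ.m j k) x.1 x.2 else 0) =
      ∑ x : Atom ν k, loopTerm ε p k j (μ.m j k) x.1 x.2 := by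
    rw [Finset.sum_ite_eq' (Finset.Icc 1 (n - 1)) k fun s =>
      ∑ x : Atom ν s, loopTerm ε p s j (μ.m j k) x.1 x.2,
      if_pos (Finset.mem_Icc.2 (by omega))]
  have e2 : (∑ s ∈ Finset.Icc 1 (n - 2), if s = k then
      ∑ x : Atom ν (s + 1), edgeTerm ε p s (s + 1) j (μ.m j k) x.1 x.2 else 0) =
      ∑ x : Atom ν (k + 1), edgeTerm ε p k (k + 1) j (μ.m j k) x.1 x.2 := by
    rw [Finset.sum_ite_eq' (Finset.Icc 1 (n - 2)) k fun s =>
      ∑ x : Atom ν (s + 1), edgeTerm ε p s (s + 1) j (μ.m j k) x.1 x.2]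
    split_ifs with hk
    · rfl
    · rw [sum_atom_outside ν (k := k + 1) (by rw [Finset.mem_Icc] at hk; omega) fun i l =>
        edgeTerm ε p k (k + 1) j (μ.m j k) i l]
  have e3 : (∑ s ∈ Finset.Icc 1 (n - 2), if s + 1 = k then
      ∑ x : Atom ν s, edgeTerm ε p (s + 1) s j (μ.m j k) x.1 x.2 else 0) =
      ∑ x : Atom ν (k - 1), edgeTerm ε p k (k - 1) j (μ.m j k) x.1 x.2 := by
    obtain ⟨k, rfl⟩ : ∃ r, k = r + 1 := ⟨k - 1, by omega⟩
    simp only [Nat.add_right_cancel_iff, Nat.add_sub_cancel]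
    rw [Finset.sum_ite_eq' (Finset.Icc 1 (n - 2)) k fun s =>
      ∑ x : Atom ν s, edgeTerm ε p (s + 1) s j (μ.m j (k + 1)) x.1 x.2]
    split_ifs with hk
    · rfl
    · exact (sum_atom_outside ν (k := k) (by rw [Finset.mem_Icc] at hk; omega) fun i l =>
        edgeTerm ε p (k + 1) k j (μ.m j (k + 1)) i l).symm
  rw [e1, e2, e3]
  abel

end TwoNodes

section Telescoping

variable (ε : ℂ) (p : ℕ)

/-- The character of weights `c - m, …` minus that of `c, …`, after telescoping. -/
def gapChar (c : ℤ) (m : ℕ) : ℂ →₀ ℤ := intChar ε (c - m) - intChar ε c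

theorem sum_range_intChar_sub (c : ℤ) (m : ℕ) :
    ∑ l ∈ Finset.range m, (intChar ε (c - l - 1) - intChar ε (c - l)) = gapChar ε c m := by
  have := Finset.sum_range_sub (fun l : ℕ => intChar ε (c - l)) m
  simp only [Nat.cast_zero, sub_zero] at this
  rw [gapChar, ← this]
  refine Finset.sum_congr rfl fun l _ => ?_
  rw [show c - l - 1 = c - ((l + 1 : ℕ) : ℤ) by push_cast; ring]

theorem sum_loopTerm_target (k j q i m : ℕ) :
    ∑ l ∈ Finset.range m, loopTerm ε p k i l j q =
      (if i ≤ j then gapChar ε ((q : ℤ) - j + i) m else 0) +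
        if i ≤ j - 1 ∧ 1 ≤ j then gapChar ε ((q : ℤ) - j + 1 + i) m else 0 := by
  have e : ∀ l, loopTerm ε p k i l j q =
      (if i ≤ j then intChar ε ((q : ℤ) - j + i - l - 1) - intChar ε ((q : ℤ) - j + i - l)
        else 0) +
      if i ≤ j - 1 ∧ 1 ≤ j then
        intChar ε ((q : ℤ) - j + 1 + i - l - 1) - intChar ε ((q : ℤ) - j + 1 + i - l) else 0 := by
    intro l
    unfold loopTerm homTerm atomWeight
    by_cases h1 : i ≤ j - 1 ∧ 1 ≤ j
    · rw [if_pos (by omega), if_pos (by omega), if_pos (by omega), if_pos (by omega),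
        if_pos (by omega), if_pos h1,
        halfChar_eq ε (v := (q : ℤ) - j + i - l - 1) (by ring),
        halfChar_eq ε (v := (q : ℤ) - j + i - l) (by ring),
        halfChar_eq ε (v := (q : ℤ) - j + 1 + i - l) (by ring),
        show (q : ℤ) - j + 1 + i - l - 1 = (q : ℤ) - j + i - l by ring]
      abel
    · rw [if_neg h1]
      by_cases h2 : i ≤ j
      · rw [if_pos (by omega), if_pos (by omega), if_neg (by omega), if_neg (by omega),
          if_pos h2,
          halfChar_eq ε (v := (q : ℤ) - j + i - l - 1) (by ring),
          halfChar_eq ε (v := (q : ℤ) - j + i - l) (by ring)]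
        abel
      · rw [if_neg (by omega), if_neg (by omega), if_neg (by omega), if_neg (by omega),
          if_neg h2]
        abel
  simp only [e, Finset.sum_add_distrib]
  congr 1 <;> split_ifs <;> first | exact sum_range_intChar_sub ε _ m | simp

theorem sum_edgeTerm_target_below (k j q i m : ℕ) (hk : 1 ≤ k) :
    ∑ l ∈ Finset.range m, edgeTerm ε p (k - 1) k i l j q =
      if i ≤ j - 1 ∧ 1 ≤ j then -gapChar ε ((q : ℤ) - j + 1 + i) m else 0 := by
  obtain ⟨k, rfl⟩ : ∃ r, k = r + 1 := ⟨k - 1, by omega⟩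
  split_ifs with h
  · rw [← sum_range_intChar_sub, ← Finset.sum_neg_distrib]
    refine Finset.sum_congr rfl fun l _ => ?_
    unfold edgeTerm homTerm atomWeight
    simp only [Nat.add_sub_cancel]
    rw [if_pos (by push_cast; omega), if_pos (by push_cast; omega),
      halfChar_eq ε (v := (q : ℤ) - j + 1 + i - l) (by push_cast; ring),
      halfChar_eq ε (v := (q : ℤ) - j + 1 + i - l - 1) (by push_cast; ring)]
    abel
  · refine Finset.sum_eq_zero fun l _ => ?_
    unfold edgeTerm homTerm
    simp only [Nat.add_sub_cancel]
    rw [if_neg (by push_cast; omega), if_neg (by push_cast; omega), sub_zero]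

theorem sum_edgeTerm_target_above (k j q i m : ℕ) :
    ∑ l ∈ Finset.range m, edgeTerm ε p (k + 1) k i l j q =
      if i ≤ j then -gapChar ε ((q : ℤ) - j + i) m else 0 := by
  split_ifs with h
  · rw [← sum_range_intChar_sub, ← Finset.sum_neg_distrib]
    refine Finset.sum_congr rfl fun l _ => ?_
    unfold edgeTerm homTerm atomWeight
    rw [if_pos (by push_cast; omega), if_pos (by push_cast; omega),
      halfChar_eq ε (v := (q : ℤ) - j + i - l) (by push_cast; ring),
      halfChar_eq ε (v := (q : ℤ) - j + i - l - 1) (by push_cast; ring)]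
    abel
  · refine Finset.sum_eq_zero fun l _ => ?_
    unfold edgeTerm homTerm
    rw [if_neg (by push_cast; omega), if_neg (by push_cast; omega), sub_zero]

/-- The character of weights `…, d + m` minus that of `…, d`, after telescoping. -/
def riseChar (d : ℤ) (m : ℕ) : ℂ →₀ ℤ := intChar ε (d + m) - intChar ε d

theorem sum_range_intChar_add (d : ℤ) (m : ℕ) :
    ∑ l ∈ Finset.range m, (intChar ε (d + l + 1) - intChar ε (d + l)) = riseChar ε d m := by
  have := Finset.sum_range_sub (fun l : ℕ => intChar ε (d + l)) m
  simp only [Nat.cast_zero, add_zero] at this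
  rw [riseChar, ← this]
  refine Finset.sum_congr rfl fun l _ => ?_
  rw [show d + l + 1 = d + ((l + 1 : ℕ) : ℤ) by push_cast; ring]

theorem sum_loopTerm_source (k j q i m : ℕ) :
    ∑ l ∈ Finset.range m, loopTerm ε p k j q i l =
      (if j ≤ i then -riseChar ε ((j : ℤ) - q - 1 - i) m else 0) +
        if j + 1 ≤ i then -riseChar ε ((j : ℤ) - q - i) m else 0 := by
  have e : ∀ l, loopTerm ε p k j q i l =
      (if j ≤ i then -(intChar ε ((j : ℤ) - q - 1 - i + l + 1) -
        intChar ε ((j : ℤ) - q - 1 - i + l)) else 0) +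
      if j + 1 ≤ i then
        -(intChar ε ((j : ℤ) - q - i + l + 1) - intChar ε ((j : ℤ) - q - i + l)) else 0 := by
    intro l
    unfold loopTerm homTerm atomWeight
    rw [show (j : ℤ) - q - 1 - i + l + 1 = (j : ℤ) - q - i + l by ring]
    by_cases h1 : j + 1 ≤ i
    · rw [if_pos (by omega), if_pos (by omega), if_pos (by omega), if_pos (by omega),
        if_pos (by omega), if_pos h1,
        halfChar_eq ε (v := (j : ℤ) - q - 1 - i + l) (by ring),
        halfChar_eq ε (v := (j : ℤ) - q - i + l) (by ring),
        halfChar_eq ε (v := (j : ℤ) - q - i + l + 1) (by ring)]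
      abel
    · rw [if_neg h1]
      by_cases h2 : j ≤ i
      · rw [if_pos (by omega), if_pos (by omega), if_neg (by omega), if_neg (by omega),
          if_pos h2,
          halfChar_eq ε (v := (j : ℤ) - q - 1 - i + l) (by ring),
          halfChar_eq ε (v := (j : ℤ) - q - i + l) (by ring)]
        abel
      · rw [if_neg (by omega), if_neg (by omega), if_neg (by omega), if_neg (by omega),
          if_neg h2]
        abel
  simp only [e, Finset.sum_add_distrib]
  congr 1 <;> split_ifs <;>
    first
    | rw [← sum_range_intChar_add, ← Finset.sum_neg_distrib]
    | simp

theorem sum_edgeTerm_source_below (k j q i m : ℕ) (hk : 1 ≤ k) :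
    ∑ l ∈ Finset.range m, edgeTerm ε p k (k - 1) j q i l =
      if j ≤ i then riseChar ε ((j : ℤ) - q - 1 - i) m else 0 := by
  obtain ⟨k, rfl⟩ : ∃ r, k = r + 1 := ⟨k - 1, by omega⟩
  split_ifs with h
  · rw [← sum_range_intChar_add]
    refine Finset.sum_congr rfl fun l _ => ?_
    unfold edgeTerm homTerm atomWeight
    simp only [Nat.add_sub_cancel]
    rw [if_pos (by push_cast; omega), if_pos (by push_cast; omega),
      halfChar_eq ε (v := (j : ℤ) - q - 1 - i + l + 1) (by push_cast; ring),
      halfChar_eq ε (v := (j : ℤ) - q - 1 - i + l) (by push_cast; ring)]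
  · refine Finset.sum_eq_zero fun l _ => ?_
    unfold edgeTerm homTerm
    simp only [Nat.add_sub_cancel]
    rw [if_neg (by push_cast; omega), if_neg (by push_cast; omega), sub_zero]

theorem sum_edgeTerm_source_above (k j q i m : ℕ) :
    ∑ l ∈ Finset.range m, edgeTerm ε p k (k + 1) j q i l =
      if j + 1 ≤ i then riseChar ε ((j : ℤ) - q - i) m else 0 := by
  split_ifs with h
  · rw [← sum_range_intChar_add]
    refine Finset.sum_congr rfl fun l _ => ?_
    unfold edgeTerm homTerm atomWeight
    rw [if_pos (by push_cast; omega), if_pos (by push_cast; omega),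
      halfChar_eq ε (v := (j : ℤ) - q - i + l + 1) (by push_cast; ring),
      halfChar_eq ε (v := (j : ℤ) - q - i + l) (by push_cast; ring)]
  · refine Finset.sum_eq_zero fun l _ => ?_
    unfold edgeTerm homTerm
    rw [if_neg (by push_cast; omega), if_neg (by push_cast; omega), sub_zero]

end Telescoping

end

section

variable {n p lam : ℕ}

theorem gapChar_l (ε : ℂ) (ν : RectPattern n p lam) (c : ℤ) (i k : ℕ) :
    gapChar ε (c + i) (ν.m i k) = intChar ε (c - ν.l i k) - intChar ε (c + i) := by
  unfold gapChar GTPattern.l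
  rw [show c + i - (ν.m i k : ℤ) = c - ((ν.m i k : ℤ) - i) by ring]

theorem riseChar_l (ε : ℂ) (ν : RectPattern n p lam) (c : ℤ) (i k : ℕ) :
    riseChar ε (c - i) (ν.m i k) = intChar ε (ν.l i k + c) - intChar ε (c - i) := by
  unfold riseChar GTPattern.l
  rw [show c - i + (ν.m i k : ℤ) = (ν.m i k : ℤ) - i + c by ring]

variable {μ μ' : RectPattern n p lam} {k j : ℕ}

theorem addWeight_eq (ε : ℂ) (k j : ℕ) (μ : RectPattern n p lam) :
    addWeight ε k j μ = ((2 * (μ.l j k + 1) + k - p : ℤ) : ℂ) * (ε / 2) := by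
  unfold addWeight
  rcases aIdx_cases p k with ⟨h1, h2⟩ | ⟨h1, h2⟩
  · rw [abs_of_nonneg (by omega)]
    have h2' : (aIdx p k : ℂ) = k + 1 - p := by rw [eq_sub_iff_add_eq]; exact_mod_cast h2
    rw [h2']; push_cast; ring
  · have h2' : (aIdx p k : ℂ) = 1 := by exact_mod_cast h2
    rw [abs_of_neg (by omega), h2']; push_cast; ring

theorem remWeight_eq_addWeight (ε : ℂ) (h : IsRaise k j μ μ') :
    remWeight ε k j μ' = addWeight ε k j μ := by
  unfold remWeight addWeight
  rw [h.l_eq]; push_cast; ring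

theorem atomWeight_eq_addWeight (ε : ℂ) (k j : ℕ) (μ : RectPattern n p lam) :
    (atomWeight p k j (μ.m j k) : ℂ) * (ε / 2) = addWeight ε k j μ := by
  rw [addWeight_eq, atomWeight, GTPattern.l]

theorem IsRaise.framingChar_target (ε : ℂ) (h : IsRaise k j μ μ') (ν : RectPattern n p lam) :
    framingChar ε ν μ' = framingChar ε ν μ + Finsupp.single (addWeight ε k j μ) 1 := by
  obtain ⟨h1, h2, h3, -⟩ := id h
  unfold framingChar
  simp only [phi_eq]
  rw [Finset.sum_congr rfl fun t _ => congrArg (· + _) (h.sum_atom_eq t fun i l =>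
    (Finsupp.single ((atomWeight p t i l : ℂ) * (ε / 2)) (1 : ℤ)))]
  simp only [Finset.sum_add_distrib]
  rw [Finset.sum_ite_eq' (Finset.Icc 1 (n - 1)) k fun t =>
    Finsupp.single ((atomWeight p t j (μ.m j k) : ℂ) * (ε / 2)) (1 : ℤ),
    if_pos (Finset.mem_Icc.2 (by omega)), atomWeight_eq_addWeight]
  abel

theorem IsRaise.framingChar_source (ε : ℂ) (h : IsRaise k j μ μ') (ν : RectPattern n p lam) :
    framingChar ε μ' ν = framingChar ε μ ν +
      Finsupp.single (-addWeight ε k j μ - if k = p then -(lam * ε) else 0) 1 := by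
  obtain ⟨h1, h2, h3, -⟩ := id h
  unfold framingChar
  simp only [phi_eq]
  rw [Finset.sum_congr rfl fun t _ => congrArg (_ + ·) (h.sum_atom_eq t fun i l =>
    (Finsupp.single (-((atomWeight p t i l : ℂ) * (ε / 2)) -
      if t = p then -(lam * ε) else 0) (1 : ℤ)))]
  simp only [Finset.sum_add_distrib]
  rw [Finset.sum_ite_eq' (Finset.Icc 1 (n - 1)) k fun t =>
    Finsupp.single (-((atomWeight p t j (μ.m j k) : ℂ) * (ε / 2)) -
      if t = p then -(lam * ε) else 0) (1 : ℤ),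
    if_pos (Finset.mem_Icc.2 (by omega)), atomWeight_eq_addWeight]
  abel

theorem sum_Icc_gapChar (ε : ℂ) (ν : RectPattern n p lam) (c : ℤ) {J s : ℕ} (hs : s ≤ n)
    (hJ : J ≤ bIdx n p s) (haJ : aIdx p s ≤ J + 1) :
    (∑ i ∈ Finset.Icc (aIdx p s) (bIdx n p s),
      if i ≤ J then gapChar ε (c + i) (ν.m i s) else 0) =
    (∑ i ∈ Finset.Icc 1 J, (intChar ε (c - ν.l i s) - intChar ε (c + i))) -
      ∑ i ∈ Finset.Icc 1 (aIdx p s - 1), gapChar ε (c + i) lam := by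
  have ha : 1 ≤ aIdx p s := by unfold aIdx; omega
  rw [sum_Icc_ite_le _ hJ, eq_sub_iff_add_eq, add_comm]
  simp only [← gapChar_l]
  rw [sum_Icc_one_split _ ha haJ]
  congr 1
  refine Finset.sum_congr rfl fun i hi => ?_
  rw [Finset.mem_Icc] at hi
  rw [RectPattern.m_eq_lam ν hi.1 (by unfold aIdx at hi; omega) hs]

theorem sum_Icc_riseChar (ε : ℂ) (ν : RectPattern n p lam) (c : ℤ) {J s : ℕ}
    (haJ : aIdx p s ≤ J) :
    (∑ i ∈ Finset.Icc (aIdx p s) (bIdx n p s),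
      if J ≤ i then riseChar ε (c - i) (ν.m i s) else 0) =
    ∑ i ∈ Finset.Icc J s, (intChar ε (ν.l i s + c) - intChar ε (c - i)) := by
  rw [sum_Icc_ite_ge _ haJ (show bIdx n p s ≤ s by unfold bIdx; omega)]
  · simp only [riseChar_l]
  · intro i hi hi'
    rw [RectPattern.m_eq_zero ν (by unfold bIdx at hi; omega)]
    simp [riseChar]

/-- The blocks that are frozen by the top row contribute only at the framed node. -/
theorem frozen_gapChar (ε : ℂ) (c : ℤ) (hk : 1 ≤ k) (lam : ℕ) :
    (∑ i ∈ Finset.Icc 1 (aIdx p (k - 1) - 1), gapChar ε (c + 1 + i) lam) +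
      (∑ i ∈ Finset.Icc 1 (aIdx p (k + 1) - 1), gapChar ε (c + i) lam) -
      (∑ i ∈ Finset.Icc 1 (aIdx p k - 1), gapChar ε (c + i) lam) -
      (∑ i ∈ Finset.Icc 1 (aIdx p k - 1), gapChar ε (c + 1 + i) lam) =
    if k = p then gapChar ε (c + 1) lam else 0 := by
  have hs : ∀ d : ℕ, gapChar ε (c + 1) lam + ∑ i ∈ Finset.Icc 1 d, gapChar ε (c + 1 + i) lam =
      ∑ i ∈ Finset.Icc 1 (d + 1), gapChar ε (c + i) lam := by
    intro d
    induction d with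
    | zero => simp
    | succ d ih =>
      rw [Finset.sum_Icc_succ_top (by omega), ← add_assoc, ih,
        Finset.sum_Icc_succ_top (b := d + 1) (by omega),
        show c + 1 + ((d + 1 : ℕ) : ℤ) = c + ((d + 1 + 1 : ℕ) : ℤ) by push_cast; ring]
  rcases lt_trichotomy k p with h | h | h
  · rw [show aIdx p (k - 1) = 1 by unfold aIdx; omega,
      show aIdx p (k + 1) = 1 by unfold aIdx; omega, show aIdx p k = 1 by unfold aIdx; omega,
      if_neg h.ne]
    simp
  · rw [show aIdx p (k - 1) = 1 by unfold aIdx; omega,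
      show aIdx p (k + 1) = 2 by unfold aIdx; omega, show aIdx p k = 1 by unfold aIdx; omega,
      if_pos h]
    simp
  · obtain ⟨d, rfl⟩ : ∃ d, k = p + 1 + d := ⟨k - p - 1, by omega⟩
    rw [show aIdx p (p + 1 + d - 1) = d + 1 by unfold aIdx; omega,
      show aIdx p (p + 1 + d + 1) = d + 3 by unfold aIdx; omega,
      show aIdx p (p + 1 + d) = d + 2 by unfold aIdx; omega,
      if_neg h.ne']
    have h1 := hs d
    have h2 := hs (d + 1)
    simp only [Nat.add_sub_cancel, show d + 2 - 1 = d + 1 by omega,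
      show d + 3 - 1 = d + 1 + 1 by omega]
    rw [← h2, ← h1]
    abel

theorem IsRaise.pairChar_target (ε : ℂ) (h : IsRaise k j μ μ') :
    pairChar ε μ' μ' - pairChar ε μ' μ =
      (intChar ε (-1) +
      (∑ i ∈ Finset.Icc 1 (j - 1), intChar ε (μ.l j k - μ.l i k)) +
      (∑ i ∈ Finset.Icc 1 (j - 1), intChar ε (μ.l j k + 1 - μ.l i k)) -
      (∑ i ∈ Finset.Icc 1 (j - 1), intChar ε (μ.l j k + 1 - μ.l i (k - 1)))) -
      (∑ i ∈ Finset.Icc 1 j, intChar ε (μ.l j k - μ.l i (k + 1))) +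
      (if k = p then gapChar ε (μ.l j k + 1) lam else 0) +
      Finsupp.single (addWeight ε k j μ) 1 := by
  obtain ⟨h1, h2, h3, -⟩ := id h
  have haj := h.aIdx_le
  have hjb := h.le_bIdx
  unfold pairChar
  rw [h.unframedChar_target, h.framingChar_target]
  rw [sum_atom μ' k fun i l => loopTerm ε p k i l j (μ.m j k),
    sum_atom μ' (k - 1) fun i l => edgeTerm ε p (k - 1) k i l j (μ.m j k),
    sum_atom μ' (k + 1) fun i l => edgeTerm ε p (k + 1) k i l j (μ.m j k)]
  simp only [sum_loopTerm_target, sum_edgeTerm_target_above,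
    fun i m => sum_edgeTerm_target_below ε p k j (μ.m j k) i m (show 1 ≤ k by omega), h1,
    and_true, Finset.sum_add_distrib]
  have hneg : ∀ (P : Prop) [Decidable P] (a : ℂ →₀ ℤ),
      (if P then -a else 0) = -(if P then a else 0) := by
    intro P _ a; split_ifs <;> simp
  simp only [hneg, Finset.sum_neg_distrib, ← GTPattern.l.eq_1 μ j k]
  rw [sum_Icc_gapChar ε μ' (μ.l j k) h3.le hjb (by omega),
    sum_Icc_gapChar ε μ' (μ.l j k + 1) (s := k) (J := j - 1) h3.le (by omega) (by omega),
    sum_Icc_gapChar ε μ' (μ.l j k + 1) (s := k - 1) (J := j - 1) (by omega)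
      (by unfold bIdx at *; omega) (by unfold aIdx at *; omega),
    sum_Icc_gapChar ε μ' (μ.l j k) (s := k + 1) h3
      (by unfold bIdx at *; omega) (by unfold aIdx at *; omega),
    ← frozen_gapChar ε (μ.l j k) (k := k) (p := p) (by omega)]
  simp only [Finset.sum_sub_distrib]
  obtain ⟨j, rfl⟩ : ∃ r, j = r + 1 := ⟨j - 1, by omega⟩
  rw [Finset.sum_Icc_succ_top (b := j) (by omega)
    (fun i => intChar ε (μ.l (j + 1) k - μ'.l i k)), h.l_eq]
  have e1 : ∀ (c : ℤ), ∑ i ∈ Finset.Icc 1 j, intChar ε (c - μ'.l i k) =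
      ∑ i ∈ Finset.Icc 1 j, intChar ε (c - μ.l i k) := fun c =>
    Finset.sum_congr rfl fun i hi => by
      rw [Finset.mem_Icc] at hi; rw [h.l_ne (by omega)]
  have e2 : ∀ (c : ℤ) (J s : ℕ), s ≠ k → ∑ i ∈ Finset.Icc 1 J, intChar ε (c - μ'.l i s) =
      ∑ i ∈ Finset.Icc 1 J, intChar ε (c - μ.l i s) := fun c J s hs =>
    Finset.sum_congr rfl fun i hi => by rw [h.l_ne (by omega)]
  simp only [Nat.add_sub_cancel]
  rw [e1, e1, e2 _ _ _ (by omega), e2 _ _ _ (by omega),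
    show μ.l (j + 1) k - (μ.l (j + 1) k + 1) = -1 by ring]
  abel

theorem IsRaise.pairChar_source (ε : ℂ) (h : IsRaise k j μ μ') :
    pairChar ε μ' μ - pairChar ε μ μ =
      (∑ i ∈ Finset.Icc (j + 1) (k + 1), intChar ε (μ.l i (k + 1) - μ.l j k)) +
      (∑ i ∈ Finset.Icc j (k - 1), intChar ε (μ.l i (k - 1) - μ.l j k - 1)) -
      (intChar ε (-1) +
      (∑ i ∈ Finset.Icc (j + 1) k, intChar ε (μ.l i k - μ.l j k)) +
      (∑ i ∈ Finset.Icc (j + 1) k, intChar ε (μ.l i k - μ.l j k - 1))) +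
      Finsupp.single (-addWeight ε k j μ - if k = p then -(lam * ε) else 0) 1 := by
  obtain ⟨h1, h2, h3, -⟩ := id h
  have haj := h.aIdx_le
  unfold pairChar
  rw [h.unframedChar_source, h.framingChar_source]
  rw [sum_atom μ k fun i l => loopTerm ε p k j (μ.m j k) i l,
    sum_atom μ (k - 1) fun i l => edgeTerm ε p k (k - 1) j (μ.m j k) i l,
    sum_atom μ (k + 1) fun i l => edgeTerm ε p k (k + 1) j (μ.m j k) i l]
  simp only [sum_loopTerm_source, sum_edgeTerm_source_above,
    fun i m => sum_edgeTerm_source_below ε p k j (μ.m j k) i m (show 1 ≤ k by omega),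
    Finset.sum_add_distrib]
  have hneg : ∀ (P : Prop) [Decidable P] (a : ℂ →₀ ℤ),
      (if P then -a else 0) = -(if P then a else 0) := by
    intro P _ a; split_ifs <;> simp
  simp only [hneg, Finset.sum_neg_distrib]
  have hl : (j : ℤ) - μ.m j k = -μ.l j k := by unfold GTPattern.l; ring
  rw [hl, sum_Icc_riseChar ε μ (-μ.l j k - 1) haj,
    sum_Icc_riseChar ε μ (-μ.l j k) (s := k) (J := j + 1) (by omega),
    sum_Icc_riseChar ε μ (-μ.l j k) (s := k + 1) (J := j + 1) (by unfold aIdx at *; omega),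
    sum_Icc_riseChar ε μ (-μ.l j k - 1) (s := k - 1) (J := j) (by unfold aIdx at *; omega)]
  simp only [Finset.sum_sub_distrib]
  rw [← Finset.add_sum_Ioc_eq_sum_Icc h2 (f := fun i => intChar ε (μ.l i k + (-μ.l j k - 1)))]
  have e0 : Finset.Ioc j k = Finset.Icc (j + 1) k := by
    ext i; simp only [Finset.mem_Ioc, Finset.mem_Icc]; omega
  have e1 : ∑ i ∈ Finset.Icc (j + 1) (k + 1), intChar ε (-μ.l j k - i) =
      (∑ i ∈ Finset.Icc (j + 1) k, intChar ε (-μ.l j k - i)) +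
        intChar ε (-μ.l j k - 1 - k) := by
    rw [Finset.sum_Icc_succ_top (by omega)]
    congr 2; push_cast; ring
  have e2 : ∑ i ∈ Finset.Icc j k, intChar ε (-μ.l j k - 1 - i) =
      (∑ i ∈ Finset.Icc j (k - 1), intChar ε (-μ.l j k - 1 - i)) +
        intChar ε (-μ.l j k - 1 - k) := by
    obtain ⟨k, rfl⟩ : ∃ r, k = r + 1 := ⟨k - 1, by omega⟩
    rw [Finset.sum_Icc_succ_top (by omega)]
    simp only [Nat.add_sub_cancel]
  rw [e0, e1, e2, show μ.l j k + (-μ.l j k - 1) = -1 by ring]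
  simp only [sub_eq_add_neg, add_assoc]
  abel

end

section

variable {n p lam : ℕ}

/-- The product of the nonzero weights of a character. -/
def weightProd (χ : ℂ →₀ ℤ) : ℂ := χ.prod fun w m => if w = 0 then 1 else w ^ m

theorem weightProd_add (χ ψ : ℂ →₀ ℤ) : weightProd (χ + ψ) = weightProd χ * weightProd ψ := by
  unfold weightProd
  refine Finsupp.prod_add_index' (fun w => by simp) fun w a b => ?_
  split_ifs with h
  · simp
  · exact zpow_add₀ h a b

theorem weightProd_zero : weightProd 0 = 1 := Finsupp.prod_zero_index

theorem weightProd_ne_zero (χ : ℂ →₀ ℤ) : weightProd χ ≠ 0 := by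
  refine Finset.prod_ne_zero_iff.2 fun w _ => ?_
  dsimp only
  split_ifs with h
  · exact one_ne_zero
  · exact zpow_ne_zero _ h

theorem weightProd_sub (χ ψ : ℂ →₀ ℤ) : weightProd (χ - ψ) = weightProd χ / weightProd ψ := by
  rw [eq_div_iff (weightProd_ne_zero ψ), ← weightProd_add, sub_add_cancel]

theorem weightProd_sum {ι : Type*} (s : Finset ι) (f : ι → ℂ →₀ ℤ) :
    weightProd (∑ i ∈ s, f i) = ∏ i ∈ s, weightProd (f i) := by
  classical
  induction s using Finset.induction_on with
  | empty => simp [weightProd_zero]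
  | insert a s ha ih => rw [Finset.sum_insert ha, Finset.prod_insert ha, weightProd_add, ih]

theorem weightProd_single (w : ℂ) : weightProd (Finsupp.single w 1) = nonzeroWeight w := by
  unfold weightProd nonzeroWeight
  rw [Finsupp.prod_single_index (by simp)]
  simp

theorem regEuler_eq (χ : ℂ →₀ ℤ) : regEuler χ = (-1) ^ (χ 0 / 2) * weightProd χ := rfl

theorem regEuler_ne_zero (χ : ℂ →₀ ℤ) : regEuler χ ≠ 0 :=
  mul_ne_zero (zpow_ne_zero _ (by norm_num)) (weightProd_ne_zero χ)

theorem eul_ne_zero (ε : ℂ) (μ : RectPattern n p lam) : eul ε μ ≠ 0 :=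
  mul_ne_zero (pow_ne_zero _ (by norm_num)) (regEuler_ne_zero _)

theorem eulInc_ne_zero (ε : ℂ) (μ μ' : RectPattern n p lam) : eulInc ε μ μ' ≠ 0 :=
  mul_ne_zero (pow_ne_zero _ (by norm_num)) (regEuler_ne_zero _)

theorem nonzeroWeight_ne_zero (w : ℂ) : nonzeroWeight w ≠ 0 := by
  unfold nonzeroWeight; split_ifs with h <;> simp [h]

theorem intChar_apply_zero {ε : ℂ} (hε : ε ≠ 0) {w : ℤ} (hw : w ≠ 0) : intChar ε w 0 = 0 := by
  unfold intChar
  rw [Finsupp.single_apply, if_neg]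
  exact mul_ne_zero (by exact_mod_cast hw) hε

theorem weightProd_intChar {ε : ℂ} (hε : ε ≠ 0) {w : ℤ} (hw : w ≠ 0) :
    weightProd (intChar ε w) = w * ε := by
  unfold intChar
  rw [weightProd_single, nonzeroWeight, if_neg]
  exact mul_ne_zero (by exact_mod_cast hw) hε

theorem sum_intChar_apply_zero {ε : ℂ} (hε : ε ≠ 0) {s : Finset ℕ} {w : ℕ → ℤ}
    (hw : ∀ i ∈ s, w i ≠ 0) : (∑ i ∈ s, intChar ε (w i)) 0 = 0 := by
  rw [Finsupp.finsetSum_apply]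
  exact Finset.sum_eq_zero fun i hi => intChar_apply_zero hε (hw i hi)

theorem weightProd_sum_intChar {ε : ℂ} (hε : ε ≠ 0) {s : Finset ℕ} {w : ℕ → ℤ}
    (hw : ∀ i ∈ s, w i ≠ 0) :
    weightProd (∑ i ∈ s, intChar ε (w i)) = (∏ i ∈ s, (w i : ℂ)) * ε ^ s.card := by
  rw [weightProd_sum, Finset.prod_congr rfl fun i hi => weightProd_intChar hε (hw i hi),
    Finset.prod_mul_distrib, Finset.prod_const]

variable {μ μ' : RectPattern n p lam} {k j : ℕ}

theorem IsRaise.l_one (h : IsRaise p j μ μ') : μ.l 1 (p + 1) = lam - 1 := by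
  unfold GTPattern.l
  rw [RectPattern.m_eq_lam μ le_rfl (by omega) h.2.2.1]; simp

theorem addWeight_framed (ε : ℂ) (j : ℕ) (μ : RectPattern n p lam) :
    addWeight ε p j μ = ((μ.l j p + 1 : ℤ) : ℂ) * ε := by
  rw [addWeight_eq]; push_cast; ring

/-- The weight-zero multiplicity that an additional atom contributes to either half of the
tangent space. -/
def zeroMult (ε : ℂ) (k j : ℕ) (μ : RectPattern n p lam) : ℤ :=
  if k ≠ p ∧ addWeight ε k j μ = 0 then 1 else 0

/-- The character of the nonzero weights of `IsRaise.pairChar_target`. -/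
def targetChar (ε : ℂ) (k j c : ℕ) (μ : RectPattern n p lam) : ℂ →₀ ℤ :=
  (intChar ε (-1) +
    (∑ i ∈ Finset.Icc 1 (j - 1), intChar ε (μ.l j k - μ.l i k)) +
    (∑ i ∈ Finset.Icc 1 (j - 1), intChar ε (μ.l j k + 1 - μ.l i k)) -
    (∑ i ∈ Finset.Icc 1 (j - 1), intChar ε (μ.l j k + 1 - μ.l i (k - 1)))) -
    (∑ i ∈ Finset.Icc c j, intChar ε (μ.l j k - μ.l i (k + 1)))

/-- The character of the nonzero weights of `IsRaise.pairChar_source`. -/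
def sourceChar (ε : ℂ) (k j : ℕ) (μ : RectPattern n p lam) : ℂ →₀ ℤ :=
  (∑ i ∈ Finset.Icc (j + 1) (k + 1), intChar ε (μ.l i (k + 1) - μ.l j k)) +
    (∑ i ∈ Finset.Icc j (k - 1), intChar ε (μ.l i (k - 1) - μ.l j k - 1)) -
    (intChar ε (-1) +
    (∑ i ∈ Finset.Icc (j + 1) k, intChar ε (μ.l i k - μ.l j k)) +
    (∑ i ∈ Finset.Icc (j + 1) k, intChar ε (μ.l i k - μ.l j k - 1)))

theorem IsRaise.target_unframed (ε : ℂ) (h : IsRaise k j μ μ') (hk : k ≠ p) :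
    pairChar ε μ' μ' - pairChar ε μ' μ =
      targetChar ε k j 1 μ + Finsupp.single (addWeight ε k j μ) 1 := by
  rw [h.pairChar_target, if_neg hk, add_zero, targetChar]

theorem IsRaise.target_framed (ε : ℂ) (h : IsRaise p j μ μ') :
    pairChar ε μ' μ' - pairChar ε μ' μ = targetChar ε p j 2 μ := by
  rw [h.pairChar_target, if_pos rfl, targetChar, addWeight_framed, ← intChar.eq_1, gapChar,
    ← Finset.add_sum_Ioc_eq_sum_Icc h.1 (f := fun i => intChar ε (μ.l j p - μ.l i (p + 1))),
    h.l_one, show μ.l j p - ((lam : ℤ) - 1) = μ.l j p + 1 - lam by ring,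
    show Finset.Ioc 1 j = Finset.Icc 2 j by
      ext i; simp only [Finset.mem_Ioc, Finset.mem_Icc]; omega]
  abel

theorem IsRaise.targetChar_apply_zero {ε : ℂ} (hε : ε ≠ 0) (h : IsRaise k j μ μ') {c : ℕ}
    (hc : 1 ≤ c) : targetChar ε k j c μ 0 = 0 := by
  unfold targetChar
  simp only [Finsupp.sub_apply, Finsupp.add_apply]
  rw [intChar_apply_zero hε (by norm_num),
    sum_intChar_apply_zero hε, sum_intChar_apply_zero hε, sum_intChar_apply_zero hε,
    sum_intChar_apply_zero hε]
  · simp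
  all_goals
    intro i hi
    rw [Finset.mem_Icc] at hi
  · have := h.lt_above_left (i := i) (by omega) hi.2; omega
  · have := h.lt_below_left (i := i) hi.1 (by omega); omega
  · have := h.lt_row_left (i := i) hi.1 (by omega); omega
  · have := h.lt_row_left (i := i) hi.1 (by omega); omega

theorem IsRaise.sourceChar_apply_zero {ε : ℂ} (hε : ε ≠ 0) (h : IsRaise k j μ μ') :
    sourceChar ε k j μ 0 = 0 := by
  obtain ⟨h1, h2, h3, -⟩ := id h
  unfold sourceChar
  simp only [Finsupp.sub_apply, Finsupp.add_apply]
  rw [intChar_apply_zero hε (by norm_num),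
    sum_intChar_apply_zero hε, sum_intChar_apply_zero hε, sum_intChar_apply_zero hε,
    sum_intChar_apply_zero hε]
  · simp
  all_goals
    intro i hi
    rw [Finset.mem_Icc] at hi
  · have := h.row_right_lt (i := i) (by omega) hi.2; omega
  · have := h.row_right_lt (i := i) (by omega) hi.2; omega
  · have := h.below_right_le (i := i) hi.1 hi.2; omega
  · have := h.above_right_lt (i := i) (by omega) hi.2; omega

theorem IsRaise.target_apply_zero {ε : ℂ} (hε : ε ≠ 0) (h : IsRaise k j μ μ') :
    (pairChar ε μ' μ' - pairChar ε μ' μ) 0 = zeroMult ε k j μ := by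
  unfold zeroMult
  by_cases hk : k = p
  · subst hk
    rw [h.target_framed, h.targetChar_apply_zero hε (by norm_num)]; simp
  · rw [h.target_unframed ε hk, Finsupp.add_apply, h.targetChar_apply_zero hε le_rfl,
      Finsupp.single_apply]
    simp [hk]

theorem IsRaise.source_apply_zero {ε : ℂ} (hε : ε ≠ 0) (h : IsRaise k j μ μ') :
    (pairChar ε μ' μ - pairChar ε μ μ) 0 = zeroMult ε k j μ := by
  unfold zeroMult
  rw [h.pairChar_source, ← sourceChar.eq_1, Finsupp.add_apply, h.sourceChar_apply_zero hε,
    Finsupp.single_apply, zero_add]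
  by_cases hk : k = p
  · subst hk
    rw [if_pos rfl, addWeight_framed, if_neg, if_neg (by simp)]
    have := h.lt_above_left le_rfl h.1
    rw [h.l_one] at this
    rw [show -(((μ.l j k + 1 : ℤ) : ℂ) * ε) - -(lam * ε) = ((lam - 1 - μ.l j k : ℤ) : ℂ) * ε by
      push_cast; ring]
    exact mul_ne_zero (by exact_mod_cast (by omega : (lam : ℤ) - 1 - μ.l j k ≠ 0)) hε
  · simp [hk]

theorem Atom.isEmpty (μ : RectPattern n p lam)
    (h : ∀ k i, k < n → aIdx p k ≤ i → μ.m i k = 0) (k : ℕ) : IsEmpty (Atom μ k) := by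
  refine ⟨fun x => ?_⟩
  have hx := x.bounds
  by_cases hk : k < n
  · have := h k _ hk hx.1; omega
  · unfold aIdx bIdx at hx; omega

theorem tangentChar_of_isEmpty (ε : ℂ) (μ : RectPattern n p lam) (h : ∀ k, IsEmpty (Atom μ k)) :
    tangentChar ε μ = 0 := by
  simp [tangentChar, pairChar, unframedChar, framingChar, homChar]

theorem even_tangentChar_zero {ε : ℂ} (hε : ε ≠ 0) (μ : RectPattern n p lam) :
    Even (tangentChar ε μ 0) := by
  refine RectPattern.induction (P := fun μ => Even (tangentChar ε μ 0)) (fun μ hμ => ?_)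
    (fun μ μ' k j h ih => ?_) μ
  · rw [tangentChar_of_isEmpty ε μ (Atom.isEmpty μ hμ)]; simp
  · have h1 := h.target_apply_zero hε
    have h2 := h.source_apply_zero hε
    rw [Finsupp.sub_apply] at h1 h2
    unfold tangentChar at *
    rw [show pairChar ε μ' μ' 0 = pairChar ε μ μ 0 + 2 * zeroMult ε k j μ by linarith]
    exact ih.add (even_two_mul _)

theorem IsRaise.numAtoms_eq (h : IsRaise k j μ μ') : numAtoms μ' = numAtoms μ + 1 := by
  obtain ⟨h1, h2, h3, -⟩ := id h
  unfold numAtoms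
  simp only [Fintype.card_eq_sum_ones]
  rw [Finset.sum_congr rfl fun t _ => h.sum_atom_eq t fun _ _ => 1, Finset.sum_add_distrib,
    Finset.sum_ite_eq' (Finset.Icc 1 (n - 1)) k fun _ => 1, if_pos (Finset.mem_Icc.2 (by omega))]

theorem zeroMult_cases (ε : ℂ) (k j : ℕ) (μ : RectPattern n p lam) :
    zeroMult ε k j μ = 0 ∨ zeroMult ε k j μ = 1 := by
  unfold zeroMult; split_ifs <;> simp

theorem IsRaise.coeffE_eq {ε : ℂ} (hε : ε ≠ 0) (h : IsRaise k j μ μ') :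
    coeffE ε μ μ' = (weightProd (pairChar ε μ' μ' - pairChar ε μ' μ))⁻¹ := by
  have e : incidenceChar ε μ μ' = tangentChar ε μ + (pairChar ε μ' μ' - pairChar ε μ' μ) := by
    unfold incidenceChar; rw [add_sub_assoc]; rfl
  have hz : incidenceChar ε μ μ' 0 / 2 = tangentChar ε μ 0 / 2 := by
    rw [e, Finsupp.add_apply, h.target_apply_zero hε]
    obtain ⟨r, hr⟩ := even_tangentChar_zero hε μ
    rcases zeroMult_cases ε k j μ with h0 | h0 <;> omega
  unfold coeffE eul eulInc
  rw [regEuler_eq, regEuler_eq, hz, e, weightProd_add]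
  have h1 := weightProd_ne_zero (tangentChar ε μ)
  have h2 := weightProd_ne_zero (pairChar ε μ' μ' - pairChar ε μ' μ)
  have h3 : (-1 : ℂ) ^ (tangentChar ε μ 0 / 2) ≠ 0 := zpow_ne_zero _ (by norm_num)
  have h4 : (-1 : ℂ) ^ numAtoms μ ≠ 0 := pow_ne_zero _ (by norm_num)
  field_simp

theorem IsRaise.coeffF_eq {ε : ℂ} (hε : ε ≠ 0) (h : IsRaise k j μ μ') :
    coeffF ε μ' μ = (if zeroMult ε k j μ = 0 then -1 else 1) *
      weightProd (pairChar ε μ' μ - pairChar ε μ μ) := by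
  have e : incidenceChar ε μ μ' = tangentChar ε μ' - (pairChar ε μ' μ - pairChar ε μ μ) := by
    unfold incidenceChar tangentChar; abel
  have hz : (-1 : ℂ) ^ (incidenceChar ε μ μ' 0 / 2) =
      (-1 : ℂ) ^ (tangentChar ε μ' 0 / 2) * if zeroMult ε k j μ = 0 then 1 else -1 := by
    rw [e, Finsupp.sub_apply, h.source_apply_zero hε]
    obtain ⟨r, hr⟩ := even_tangentChar_zero hε μ'
    rcases zeroMult_cases ε k j μ with h0 | h0
    · rw [h0, sub_zero]; simp
    · rw [h0, show (tangentChar ε μ' 0 - 1) / 2 = tangentChar ε μ' 0 / 2 - 1 by omega,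
        zpow_sub₀ (by norm_num)]
      norm_num [div_neg]
  unfold coeffF eul eulInc
  rw [regEuler_eq, regEuler_eq, hz, e, weightProd_sub, h.numAtoms_eq, pow_succ]
  have h1 := weightProd_ne_zero (tangentChar ε μ')
  have h2 := weightProd_ne_zero (pairChar ε μ' μ - pairChar ε μ μ)
  have h3 : (-1 : ℂ) ^ (tangentChar ε μ' 0 / 2) ≠ 0 := zpow_ne_zero _ (by norm_num)
  have h4 : (-1 : ℂ) ^ numAtoms μ ≠ 0 := pow_ne_zero _ (by norm_num)
  split_ifs <;> field_simp

theorem prod_sub_swap (s : Finset ℕ) (f g : ℕ → ℂ) :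
    ∏ i ∈ s, (f i - g i) = (-1) ^ s.card * ∏ i ∈ s, (g i - f i) := by
  rw [← Finset.prod_const, ← Finset.prod_mul_distrib]
  exact Finset.prod_congr rfl fun i _ => by ring

theorem IsRaise.weightProd_targetChar {ε : ℂ} (hε : ε ≠ 0) (h : IsRaise k j μ μ') {c : ℕ}
    (hc : 1 ≤ c) :
    (weightProd (targetChar ε k j c μ))⁻¹ =
      (∏ i ∈ Finset.Icc c j, ((μ.l i (k + 1) : ℂ) - μ.l j k)) *
        (∏ i ∈ Finset.Icc 1 (j - 1), ((μ.l i (k - 1) : ℂ) - μ.l j k - 1)) /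
      (∏ i ∈ Finset.Icc 1 (j - 1), (((μ.l i k : ℂ) - μ.l j k) * ((μ.l i k : ℂ) - μ.l j k - 1))) *
      ((-ε) ^ (j + 1 - c) / (-ε) ^ j) := by
  obtain ⟨h1, h2, h3, -⟩ := id h
  unfold targetChar
  have w1 : ∀ i ∈ Finset.Icc 1 (j - 1), μ.l j k - μ.l i k ≠ 0 := fun i hi => by
    rw [Finset.mem_Icc] at hi
    have := h.lt_row_left (i := i) hi.1 (by omega); omega
  have w2 : ∀ i ∈ Finset.Icc 1 (j - 1), μ.l j k + 1 - μ.l i k ≠ 0 := fun i hi => by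
    rw [Finset.mem_Icc] at hi
    have := h.lt_row_left (i := i) hi.1 (by omega); omega
  have w3 : ∀ i ∈ Finset.Icc 1 (j - 1), μ.l j k + 1 - μ.l i (k - 1) ≠ 0 := fun i hi => by
    rw [Finset.mem_Icc] at hi
    have := h.lt_below_left (i := i) hi.1 (by omega); omega
  have w4 : ∀ i ∈ Finset.Icc c j, μ.l j k - μ.l i (k + 1) ≠ 0 := fun i hi => by
    rw [Finset.mem_Icc] at hi
    have := h.lt_above_left (i := i) (by omega) hi.2; omega
  rw [weightProd_sub, weightProd_sub, weightProd_add, weightProd_add,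
    weightProd_sum_intChar hε w1, weightProd_sum_intChar hε w2, weightProd_sum_intChar hε w3,
    weightProd_sum_intChar hε w4, weightProd_intChar hε (by norm_num)]
  push_cast
  have n1 := Finset.prod_ne_zero_iff.2 fun i hi => Int.cast_ne_zero (α := ℂ).2 (w1 i hi)
  have n2 := Finset.prod_ne_zero_iff.2 fun i hi => Int.cast_ne_zero (α := ℂ).2 (w2 i hi)
  have n3 := Finset.prod_ne_zero_iff.2 fun i hi => Int.cast_ne_zero (α := ℂ).2 (w3 i hi)
  have n4 := Finset.prod_ne_zero_iff.2 fun i hi => Int.cast_ne_zero (α := ℂ).2 (w4 i hi)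
  push_cast at n1 n2 n3 n4
  rw [Finset.prod_mul_distrib]
  simp only [sub_sub]
  rw [prod_sub_swap _ _ fun i => (μ.l j k : ℂ), prod_sub_swap _ _ fun i => (μ.l j k : ℂ) + 1,
    prod_sub_swap _ _ fun i => (μ.l j k : ℂ), prod_sub_swap _ _ fun i => (μ.l j k : ℂ) + 1]
  simp only [Nat.card_Icc]
  obtain ⟨j, rfl⟩ : ∃ r, j = r + 1 := ⟨j - 1, by omega⟩
  simp only [Nat.add_sub_cancel] at *
  have hs : ((-1 : ℂ) ^ j) ≠ 0 := pow_ne_zero _ (by norm_num)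
  have sq : ∀ a : ℕ, ((-1 : ℂ) ^ a) ^ 2 = 1 := fun a => by
    rw [← pow_mul, mul_comm, pow_mul]; norm_num
  rw [neg_pow ε (j + 1), neg_pow ε (j + 1 + 1 - c), pow_succ, pow_succ ε]
  field_simp
  rw [sq, sq]

theorem IsRaise.weightProd_sourceChar {ε : ℂ} (hε : ε ≠ 0) (h : IsRaise k j μ μ') :
    weightProd (sourceChar ε k j μ) =
      -((∏ i ∈ Finset.Icc (j + 1) (k + 1), ((μ'.l i (k + 1) : ℂ) - μ'.l j k + 1)) *
        (∏ i ∈ Finset.Icc j (k - 1), ((μ'.l i (k - 1) : ℂ) - μ'.l j k)) /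
      (∏ i ∈ Finset.Icc (j + 1) k,
        (((μ'.l i k : ℂ) - μ'.l j k + 1) * ((μ'.l i k : ℂ) - μ'.l j k)))) := by
  obtain ⟨h1, h2, h3, -⟩ := id h
  unfold sourceChar
  have w1 : ∀ i ∈ Finset.Icc (j + 1) k, μ.l i k - μ.l j k ≠ 0 := fun i hi => by
    rw [Finset.mem_Icc] at hi
    have := h.row_right_lt (i := i) (by omega) hi.2; omega
  have w2 : ∀ i ∈ Finset.Icc (j + 1) k, μ.l i k - μ.l j k - 1 ≠ 0 := fun i hi => by
    rw [Finset.mem_Icc] at hi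
    have := h.row_right_lt (i := i) (by omega) hi.2; omega
  have w3 : ∀ i ∈ Finset.Icc j (k - 1), μ.l i (k - 1) - μ.l j k - 1 ≠ 0 := fun i hi => by
    rw [Finset.mem_Icc] at hi
    have := h.below_right_le (i := i) hi.1 hi.2; omega
  have w4 : ∀ i ∈ Finset.Icc (j + 1) (k + 1), μ.l i (k + 1) - μ.l j k ≠ 0 := fun i hi => by
    rw [Finset.mem_Icc] at hi
    have := h.above_right_lt (i := i) (by omega) hi.2; omega
  rw [weightProd_sub, weightProd_add, weightProd_add, weightProd_add,
    weightProd_sum_intChar hε w1, weightProd_sum_intChar hε w2, weightProd_sum_intChar hε w3,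
    weightProd_sum_intChar hε w4, weightProd_intChar hε (by norm_num)]
  have n1 := Finset.prod_ne_zero_iff.2 fun i hi => Int.cast_ne_zero (α := ℂ).2 (w1 i hi)
  have n2 := Finset.prod_ne_zero_iff.2 fun i hi => Int.cast_ne_zero (α := ℂ).2 (w2 i hi)
  have e1 : ∏ i ∈ Finset.Icc (j + 1) k,
      (((μ'.l i k : ℂ) - μ'.l j k + 1) * ((μ'.l i k : ℂ) - μ'.l j k)) =
      (∏ i ∈ Finset.Icc (j + 1) k, ((μ.l i k - μ.l j k : ℤ) : ℂ)) *
      ∏ i ∈ Finset.Icc (j + 1) k, ((μ.l i k - μ.l j k - 1 : ℤ) : ℂ) := by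
    rw [← Finset.prod_mul_distrib]
    refine Finset.prod_congr rfl fun i hi => ?_
    rw [Finset.mem_Icc] at hi
    rw [h.l_eq, h.l_ne (by omega)]; push_cast; ring
  have e3 : ∏ i ∈ Finset.Icc j (k - 1), ((μ'.l i (k - 1) : ℂ) - μ'.l j k) =
      ∏ i ∈ Finset.Icc j (k - 1), ((μ.l i (k - 1) - μ.l j k - 1 : ℤ) : ℂ) :=
    Finset.prod_congr rfl fun i hi => by
      rw [h.l_eq, h.l_ne (by omega)]; push_cast; ring
  have e4 : ∏ i ∈ Finset.Icc (j + 1) (k + 1), ((μ'.l i (k + 1) : ℂ) - μ'.l j k + 1) =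
      ∏ i ∈ Finset.Icc (j + 1) (k + 1), ((μ.l i (k + 1) - μ.l j k : ℤ) : ℂ) :=
    Finset.prod_congr rfl fun i hi => by
      rw [h.l_eq, h.l_ne (by omega)]; push_cast; ring
  rw [e1, e3, e4]
  simp only [Nat.card_Icc]
  obtain ⟨d, rfl⟩ : ∃ d, k = j + d := ⟨k - j, by omega⟩
  rw [show j + d + 1 + 1 - (j + 1) = d + 1 by omega, show j + d - 1 + 1 - j = d by omega,
    show j + d + 1 - (j + 1) = d by omega]
  push_cast at n1 n2 ⊢
  field_simp
  ring

theorem nonzeroWeight_neg {w : ℂ} (hw : w ≠ 0) : nonzeroWeight (-w) = -nonzeroWeight w := by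
  simp [nonzeroWeight, hw]

theorem IsRaise.coeffE_unframed {ε : ℂ} (hε : ε ≠ 0) (h : IsRaise k j μ μ') (hk : k ≠ p) :
    coeffE ε μ μ' = formulaE ε k j μ := by
  rw [h.coeffE_eq hε, h.target_unframed ε hk, weightProd_add, mul_inv,
    h.weightProd_targetChar hε le_rfl, weightProd_single, formulaE, Nat.add_sub_cancel,
    div_self (pow_ne_zero _ (neg_ne_zero.2 hε)), mul_one, one_div]

theorem IsRaise.coeffE_framed {ε : ℂ} (hε : ε ≠ 0) (h : IsRaise p j μ μ') :
    coeffE ε μ μ' = formulaEp ε j μ := by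
  obtain ⟨h1, h2, h3, -⟩ := id h
  rw [h.coeffE_eq hε, h.target_framed, h.weightProd_targetChar hε (by norm_num), formulaEp]
  obtain ⟨j, rfl⟩ : ∃ r, j = r + 1 := ⟨j - 1, by omega⟩
  rw [show j + 1 + 1 - 2 = j by omega, pow_succ,
    show (-ε) ^ j / ((-ε) ^ j * -ε) = -(1 / ε) by
      have := pow_ne_zero j (neg_ne_zero.2 hε); field_simp]
  ring

theorem IsRaise.coeffF_unframed {ε : ℂ} (hε : ε ≠ 0) (h : IsRaise k j μ μ') (hk : k ≠ p) :
    coeffF ε μ' μ = formulaF ε k j μ' := by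
  rw [h.coeffF_eq hε, h.pairChar_source, ← sourceChar.eq_1, weightProd_add,
    h.weightProd_sourceChar hε, weightProd_single, formulaF, remWeight_eq_addWeight ε h,
    if_neg hk, sub_zero]
  unfold zeroMult
  by_cases hw : addWeight ε k j μ = 0
  · simp only [hw, hk, ne_eq, not_false_eq_true, and_self, if_true, one_ne_zero, if_false, neg_zero]
    ring
  · simp only [hw, and_false, if_true, if_false, nonzeroWeight_neg hw]
    ring

theorem IsRaise.coeffF_framed {ε : ℂ} (hε : ε ≠ 0) (h : IsRaise p j μ μ') :
    coeffF ε μ' μ = formulaFp ε j μ' := by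
  have hlt := h.lt_above_left le_rfl h.1
  have e : -addWeight ε p j μ - -(lam * ε) = ((μ'.l 1 (p + 1) : ℂ) - μ'.l j p + 1) * ε := by
    rw [addWeight_framed, h.l_eq, h.l_ne (by omega), h.l_one]; push_cast; ring
  have e0 : ((μ'.l 1 (p + 1) : ℂ) - μ'.l j p + 1) * ε ≠ 0 := by
    refine mul_ne_zero ?_ hε
    rw [h.l_eq, h.l_ne (by omega)]
    exact_mod_cast (by omega : μ.l 1 (p + 1) - (μ.l j p + 1) + 1 ≠ 0)
  rw [h.coeffF_eq hε, h.pairChar_source, ← sourceChar.eq_1, weightProd_add,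
    h.weightProd_sourceChar hε, weightProd_single, formulaFp, if_pos rfl, e, nonzeroWeight,
    if_neg e0, zeroMult]
  simp only [ne_eq, not_true_eq_false, false_and, if_false, if_true]
  ring

end

section

variable {n p lam : ℕ}

section Radicands

variable {top : ℕ → ℕ} {μ μ' : GTPattern n top} {k j : ℕ}

/-- The factors of the raising radicand that stem from the entries to the left of `m_{j,k}`. -/
def leftFactor (k j : ℕ) (μ : GTPattern n top) : ℝ :=
  (∏ i ∈ Finset.Icc 1 j, ((μ.l i (k + 1) : ℝ) - μ.l j k)) *
      (∏ i ∈ Finset.Icc 1 (j - 1), ((μ.l i (k - 1) : ℝ) - μ.l j k - 1)) /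
    ∏ i ∈ Finset.Icc 1 (j - 1), (((μ.l i k : ℝ) - μ.l j k) * ((μ.l i k : ℝ) - μ.l j k - 1))

/-- The factors of the raising radicand that stem from the entries to the right of `m_{j,k}`. -/
def rightFactor (k j : ℕ) (μ : GTPattern n top) : ℝ :=
  -((∏ i ∈ Finset.Icc (j + 1) (k + 1), ((μ.l i (k + 1) : ℝ) - μ.l j k)) *
      (∏ i ∈ Finset.Icc j (k - 1), ((μ.l i (k - 1) : ℝ) - μ.l j k - 1)) /
    ∏ i ∈ Finset.Icc (j + 1) k, (((μ.l i k : ℝ) - μ.l j k) * ((μ.l i k : ℝ) - μ.l j k - 1)))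

theorem prod_Icc_split {M : Type*} [CommMonoid M] (g : ℕ → M) {a b J : ℕ} (ha : a ≤ J + 1)
    (hb : J ≤ b) :
    ∏ i ∈ Finset.Icc a b, g i = (∏ i ∈ Finset.Icc a J, g i) * ∏ i ∈ Finset.Icc (J + 1) b, g i := by
  rw [← Finset.prod_union]
  · congr 1; ext i; simp only [Finset.mem_union, Finset.mem_Icc]; omega
  · rw [Finset.disjoint_left]; intro i; simp only [Finset.mem_Icc]; omega

theorem gtRadicandE_eq (h1 : 1 ≤ j) (h2 : j ≤ k) :
    gtRadicandE k j μ = leftFactor k j μ * rightFactor k j μ := by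
  have e : (Finset.Icc 1 k).erase j = Finset.Icc 1 (j - 1) ∪ Finset.Icc (j + 1) k := by
    ext i; simp only [Finset.mem_union, Finset.mem_erase, Finset.mem_Icc]; omega
  have hd : Disjoint (Finset.Icc 1 (j - 1)) (Finset.Icc (j + 1) k) := by
    rw [Finset.disjoint_left]; intro i; simp only [Finset.mem_Icc]; omega
  unfold gtRadicandE leftFactor rightFactor
  rw [e, Finset.prod_union hd,
    prod_Icc_split _ (show 1 ≤ j + 1 by omega) (show j ≤ k + 1 by omega),
    prod_Icc_split _ (a := 1) (b := k - 1) (J := j - 1) (by omega) (by omega),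
    Nat.sub_add_cancel h1]
  ring

theorem IsRaise.gtRadicandF_eq (h : IsRaise k j μ μ') :
    gtRadicandF k j μ' = gtRadicandE k j μ := by
  obtain ⟨h1, h2, h3, -⟩ := id h
  unfold gtRadicandF gtRadicandE
  rw [h.l_eq]
  congr 1
  · congr 2 <;>
    · refine Finset.prod_congr rfl fun i hi => ?_
      rw [h.l_ne (by omega)]; push_cast; ring
  · refine Finset.prod_congr rfl fun i hi => ?_
    rw [h.l_ne (fun e => (Finset.mem_erase.1 hi).1 e.1)]; push_cast; ring

theorem IsRaise.leftFactor_pos (h : IsRaise k j μ μ') : 0 < leftFactor k j μ := by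
  obtain ⟨h1, h2, h3, -⟩ := id h
  refine div_pos (mul_pos ?_ ?_) ?_ <;> refine Finset.prod_pos fun i hi => ?_ <;>
    rw [Finset.mem_Icc] at hi
  · have := h.lt_above_left hi.1 hi.2
    exact_mod_cast (by omega : 0 < μ.l i (k + 1) - μ.l j k)
  · have := h.lt_below_left hi.1 (by omega)
    exact_mod_cast (by omega : 0 < μ.l i (k - 1) - μ.l j k - 1)
  · have := h.lt_row_left hi.1 (by omega)
    exact mul_pos (by exact_mod_cast (by omega : 0 < μ.l i k - μ.l j k))
      (by exact_mod_cast (by omega : 0 < μ.l i k - μ.l j k - 1))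

theorem prod_sub_eq_neg_one_pow (s : Finset ℕ) (f : ℕ → ℝ) :
    ∏ i ∈ s, f i = (-1) ^ s.card * ∏ i ∈ s, -f i := by
  rw [← Finset.prod_const, ← Finset.prod_mul_distrib]
  exact Finset.prod_congr rfl fun i _ => by ring

theorem IsRaise.rightFactor_pos (h : IsRaise k j μ μ') : 0 < rightFactor k j μ := by
  obtain ⟨h1, h2, h3, -⟩ := id h
  unfold rightFactor
  rw [prod_sub_eq_neg_one_pow (Finset.Icc (j + 1) (k + 1)),
    prod_sub_eq_neg_one_pow (Finset.Icc j (k - 1))]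
  simp only [Nat.card_Icc]
  obtain ⟨d, rfl⟩ : ∃ d, k = j + d := ⟨k - j, by omega⟩
  rw [show j + d + 1 + 1 - (j + 1) = d + 1 by omega, show j + d - 1 + 1 - j = d by omega]
  have p1 : 0 < ∏ i ∈ Finset.Icc (j + 1) (j + d + 1),
      -((μ.l i (j + d + 1) : ℝ) - μ.l j (j + d)) := by
    refine Finset.prod_pos fun i hi => ?_
    rw [Finset.mem_Icc] at hi
    have := h.above_right_lt (i := i) (by omega) hi.2
    exact_mod_cast (by omega : 0 < -(μ.l i (j + d + 1) - μ.l j (j + d)))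
  have p2 : 0 < ∏ i ∈ Finset.Icc j (j + d - 1),
      -((μ.l i (j + d - 1) : ℝ) - μ.l j (j + d) - 1) := by
    refine Finset.prod_pos fun i hi => ?_
    rw [Finset.mem_Icc] at hi
    have := h.below_right_le hi.1 hi.2
    exact_mod_cast (by omega : 0 < -(μ.l i (j + d - 1) - μ.l j (j + d) - 1))
  have p3 : 0 < ∏ i ∈ Finset.Icc (j + 1) (j + d),
      (((μ.l i (j + d) : ℝ) - μ.l j (j + d)) * ((μ.l i (j + d) : ℝ) - μ.l j (j + d) - 1)) := by
    refine Finset.prod_pos fun i hi => ?_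
    rw [Finset.mem_Icc] at hi
    have := h.row_right_lt (i := i) (by omega) hi.2
    exact mul_pos_of_neg_of_neg
      (by exact_mod_cast (by omega : μ.l i (j + d) - μ.l j (j + d) < 0))
      (by exact_mod_cast (by omega : μ.l i (j + d) - μ.l j (j + d) - 1 < 0))
  have hs : ((-1 : ℝ) ^ d) * (-1) ^ d = 1 := by
    rw [← mul_pow]; norm_num
  have key : ∀ a b : ℝ, 0 < a → 0 < b → 0 < -((-1) ^ d * -1 * a * ((-1) ^ d * b)) := by
    intro a b ha hb
    rw [show -((-1) ^ d * -1 * a * ((-1) ^ d * b)) = (-1) ^ d * (-1) ^ d * (a * b) by ring, hs,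
      one_mul]
    exact mul_pos ha hb
  rw [← neg_div, pow_succ]
  exact div_pos (key _ _ p1 p2) p3

end Radicands

section Operators

variable {k : ℕ}

theorem raisingOp_comp_rescale {s t : Finset ℕ} (hst : s ⊆ t) (N : RectPattern n p lam → ℂ)
    {c c' : ℕ → RectPattern n p lam → RectPattern n p lam → ℂ}
    (hs : ∀ j (μ μ' : RectPattern n p lam), IsRaise k j μ μ' → j ∈ s)
    (hc : ∀ j μ μ', IsRaise k j μ μ' → (N μ)⁻¹ * c j μ μ' = c' j μ μ' * (N μ')⁻¹) :
    raisingOp k s c ∘ₗ rescale N = rescale N ∘ₗ raisingOp k t c' := by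
  classical
  refine Finsupp.lhom_ext' fun μ => LinearMap.ext_ring ?_
  simp only [LinearMap.comp_apply, Finsupp.lsingle_apply, rescale, raisingOp,
    Finsupp.linearCombination_single, one_smul, map_sum]
  rw [Finset.smul_sum]
  refine (Finset.sum_congr rfl fun j _ => ?_).trans (Finset.sum_subset hst fun j _ hj => ?_)
  · split_ifs with h
    · rw [Finsupp.linearCombination_single, Finsupp.smul_single, Finsupp.smul_single, smul_eq_mul,
        smul_eq_mul, hc j μ _ h.choose_spec]
    · simp
  · rw [dif_neg fun h => hj (hs j μ _ h.choose_spec), map_zero]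

theorem loweringOp_comp_rescale {s t : Finset ℕ} (hst : s ⊆ t) (N : RectPattern n p lam → ℂ)
    {c c' : ℕ → RectPattern n p lam → RectPattern n p lam → ℂ}
    (hs : ∀ j (μ μ' : RectPattern n p lam), IsRaise k j μ μ' → j ∈ s)
    (hc : ∀ j μ μ', IsRaise k j μ μ' → (N μ')⁻¹ * c j μ' μ = c' j μ' μ * (N μ)⁻¹) :
    loweringOp k s c ∘ₗ rescale N = rescale N ∘ₗ loweringOp k t c' := by
  classical
  refine Finsupp.lhom_ext' fun μ => LinearMap.ext_ring ?_
  simp only [LinearMap.comp_apply, Finsupp.lsingle_apply, rescale, loweringOp,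
    Finsupp.linearCombination_single, one_smul, map_sum]
  rw [Finset.smul_sum]
  refine (Finset.sum_congr rfl fun j _ => ?_).trans (Finset.sum_subset hst fun j _ hj => ?_)
  · split_ifs with h
    · rw [Finsupp.linearCombination_single, Finsupp.smul_single, Finsupp.smul_single, smul_eq_mul,
        smul_eq_mul, hc j _ μ h.choose_spec]
    · simp
  · rw [dif_neg fun h => hj (hs j _ μ h.choose_spec), map_zero]

end Operators

section Normalisation

variable {μ μ' : RectPattern n p lam} {k j : ℕ} {ε : ℂ}

/-- The framing factor of the coefficients: `E` is the left factor of the radicand divided by it,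
and `F` is the right factor multiplied by it. -/
def framingFactor (ε : ℂ) (k j : ℕ) (μ : RectPattern n p lam) : ℂ :=
  if k = p then ((μ.l 1 (p + 1) - μ.l j p : ℤ) : ℂ) * -ε else nonzeroWeight (addWeight ε k j μ)

theorem IsRaise.coeffE_eq_div (hε : ε ≠ 0) (h : IsRaise k j μ μ') :
    coeffE ε μ μ' = (leftFactor k j μ : ℂ) / framingFactor ε k j μ := by
  unfold framingFactor
  split_ifs with hk
  · subst hk
    have hlt := h.lt_above_left le_rfl h.1
    have h0 : (μ.l 1 (k + 1) : ℂ) - μ.l j k ≠ 0 := by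
      exact_mod_cast (by omega : μ.l 1 (k + 1) - μ.l j k ≠ 0)
    rw [h.coeffE_framed hε, formulaEp, leftFactor]
    push_cast
    rw [← Finset.mul_prod_Ioc_eq_prod_Icc h.1
      (f := fun i => (μ.l i (k + 1) : ℂ) - μ.l j k), show Finset.Ioc 1 j = Finset.Icc 2 j by
      ext i; simp only [Finset.mem_Ioc, Finset.mem_Icc]; omega]
    field_simp
  · rw [h.coeffE_unframed hε hk, formulaE, leftFactor]
    push_cast
    ring

theorem IsRaise.coeffF_eq_mul (hε : ε ≠ 0) (h : IsRaise k j μ μ') :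
    coeffF ε μ' μ = (rightFactor k j μ : ℂ) * framingFactor ε k j μ := by
  obtain ⟨h1, h2, h3, -⟩ := id h
  have e1 : (rightFactor k j μ : ℂ) =
      -((∏ i ∈ Finset.Icc (j + 1) (k + 1), ((μ'.l i (k + 1) : ℂ) - μ'.l j k + 1)) *
        (∏ i ∈ Finset.Icc j (k - 1), ((μ'.l i (k - 1) : ℂ) - μ'.l j k)) /
      (∏ i ∈ Finset.Icc (j + 1) k,
        (((μ'.l i k : ℂ) - μ'.l j k + 1) * ((μ'.l i k : ℂ) - μ'.l j k)))) := by
    unfold rightFactor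
    rw [h.l_eq]
    push_cast
    congr 2
    · congr 1 <;>
      · refine Finset.prod_congr rfl fun i hi => ?_
        rw [h.l_ne (by omega)]; ring
    · refine Finset.prod_congr rfl fun i hi => ?_
      rw [Finset.mem_Icc] at hi
      rw [h.l_ne (by omega)]; ring
  rw [e1]
  unfold framingFactor
  split_ifs with hk
  · subst hk
    rw [h.coeffF_framed hε, formulaFp, ← h.l_ne (i := 1) (r := k + 1) (by omega),
      show μ'.l 1 (k + 1) - μ.l j k = μ'.l 1 (k + 1) - μ'.l j k + 1 by rw [h.l_eq]; ring]
    push_cast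
    ring
  · rw [h.coeffF_unframed hε hk, formulaF, remWeight_eq_addWeight ε h]
    ring

/-- The framing factor of an atom, up to a positive multiple. -/
def atomFactor (ε : ℂ) (p k i l : ℕ) : ℂ :=
  if k = p then -ε else nonzeroWeight (atomWeight p k i l * (ε / 2))

theorem atomFactor_ne_zero (hε : ε ≠ 0) (p k i l : ℕ) : atomFactor ε p k i l ≠ 0 := by
  unfold atomFactor
  split_ifs
  · exact neg_ne_zero.2 hε
  · exact nonzeroWeight_ne_zero _

/-- The product of the framing factors of all the atoms. -/
def atomProd (ε : ℂ) (μ : RectPattern n p lam) : ℂ :=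
  ∏ k ∈ Finset.Icc 1 (n - 1), ∏ x : Atom μ k, atomFactor ε p k x.1 x.2

theorem atomProd_ne_zero (hε : ε ≠ 0) (μ : RectPattern n p lam) : atomProd ε μ ≠ 0 :=
  Finset.prod_ne_zero_iff.2 fun _ _ => Finset.prod_ne_zero_iff.2 fun _ _ =>
    atomFactor_ne_zero hε _ _ _ _

theorem IsRaise.atomProd_eq (h : IsRaise k j μ μ') :
    atomProd ε μ' = atomProd ε μ * atomFactor ε p k j (μ.m j k) := by
  obtain ⟨h1, h2, h3, -⟩ := id h
  unfold atomProd
  rw [Finset.prod_congr rfl fun t _ => h.prod_atom_eq t (atomFactor ε p t),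
    Finset.prod_mul_distrib, Finset.prod_ite_eq' (Finset.Icc 1 (n - 1)) k fun t =>
      atomFactor ε p t j (μ.m j k), if_pos (Finset.mem_Icc.2 (by omega))]

theorem IsRaise.framingFactor_eq (h : IsRaise k j μ μ') :
    ∃ c : ℝ, 0 < c ∧ framingFactor ε k j μ = c * atomFactor ε p k j (μ.m j k) := by
  unfold framingFactor atomFactor
  split_ifs with hk
  · subst hk
    have hlt := h.lt_above_left le_rfl h.1
    exact ⟨((μ.l 1 (k + 1) - μ.l j k : ℤ) : ℝ), by exact_mod_cast (by omega), by push_cast; ring⟩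
  · exact ⟨1, one_pos, by rw [atomWeight_eq_addWeight]; simp⟩

theorem framingFactor_ne_zero (hε : ε ≠ 0) (h : IsRaise k j μ μ') :
    framingFactor ε k j μ ≠ 0 := by
  obtain ⟨c, hc, e⟩ := h.framingFactor_eq (ε := ε)
  rw [e]
  exact mul_ne_zero (by exact_mod_cast hc.ne') (atomFactor_ne_zero hε _ _ _ _)

/-- The norms of the states. -/
def stateNorm (ε : ℂ) (μ : RectPattern n p lam) : ℂ :=
  (Real.sqrt ‖eul ε μ‖ / ‖atomProd ε μ‖ : ℝ) * atomProd ε μ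

theorem stateNorm_ne_zero (hε : ε ≠ 0) (μ : RectPattern n p lam) : stateNorm ε μ ≠ 0 := by
  have h1 := norm_pos_iff.2 (eul_ne_zero ε μ)
  have h2 := norm_pos_iff.2 (atomProd_ne_zero hε μ)
  refine mul_ne_zero ?_ (atomProd_ne_zero hε μ)
  exact_mod_cast (div_pos (Real.sqrt_pos.2 h1) h2).ne'

theorem IsRaise.eul_eq (hε : ε ≠ 0) (h : IsRaise k j μ μ') :
    eul ε μ' = ((rightFactor k j μ / leftFactor k j μ : ℝ) : ℂ) *
      framingFactor ε k j μ ^ 2 * eul ε μ := by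
  have hE := h.coeffE_eq_div hε
  have hF := h.coeffF_eq_mul hε
  have h1 := eulInc_ne_zero ε μ μ'
  have h2 := framingFactor_ne_zero hε h
  have h3 : (leftFactor k j μ : ℂ) ≠ 0 := by exact_mod_cast h.leftFactor_pos.ne'
  rw [coeffE, div_eq_div_iff h1 h2] at hE
  rw [coeffF, div_eq_iff h1] at hF
  rw [hF]
  push_cast
  field_simp
  linear_combination (-(rightFactor k j μ : ℂ)) * hE

theorem IsRaise.stateNorm_eq (hε : ε ≠ 0) (h : IsRaise k j μ μ') :
    stateNorm ε μ' = (Real.sqrt (rightFactor k j μ / leftFactor k j μ) : ℂ) *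
      framingFactor ε k j μ * stateNorm ε μ := by
  obtain ⟨c, hc, e⟩ := h.framingFactor_eq (ε := ε)
  have hr := (div_pos h.rightFactor_pos h.leftFactor_pos).le
  have ha := norm_pos_iff.2 (atomFactor_ne_zero hε p k j (μ.m j k))
  have hp := norm_pos_iff.2 (atomProd_ne_zero hε μ)
  have e2 : Real.sqrt ‖eul ε μ'‖ = Real.sqrt (rightFactor k j μ / leftFactor k j μ) *
      (c * ‖atomFactor ε p k j (μ.m j k)‖) * Real.sqrt ‖eul ε μ‖ := by
    rw [h.eul_eq hε, e, norm_mul, norm_mul, norm_pow, norm_mul, Complex.norm_real,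
      Complex.norm_real, Real.norm_of_nonneg hr, Real.norm_of_nonneg hc.le,
      Real.sqrt_mul (by positivity), Real.sqrt_mul hr, Real.sqrt_sq (by positivity)]
  have ha' : ((‖atomFactor ε p k j (μ.m j k)‖ : ℝ) : ℂ) ≠ 0 := by exact_mod_cast ha.ne'
  have hp' : ((‖atomProd ε μ‖ : ℝ) : ℂ) ≠ 0 := by exact_mod_cast hp.ne'
  unfold stateNorm
  rw [h.atomProd_eq, norm_mul, e2, e]
  push_cast
  field_simp

theorem stateNorm_sq (hε : ε ≠ 0) (μ : RectPattern n p lam) : stateNorm ε μ ^ 2 = eul ε μ := by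
  refine RectPattern.induction (P := fun μ => stateNorm ε μ ^ 2 = eul ε μ) (fun μ hμ => ?_)
    (fun μ μ' k j h ih => ?_) μ
  · have hE := Atom.isEmpty μ hμ
    have e1 : eul ε μ = 1 := by
      rw [eul, tangentChar_of_isEmpty ε μ hE, regEuler_eq, weightProd_zero]
      simp [numAtoms]
    have e2 : atomProd ε μ = 1 := by simp [atomProd]
    simp [stateNorm, e1, e2]
  · have hr := (div_pos h.rightFactor_pos h.leftFactor_pos).le
    rw [h.stateNorm_eq hε, h.eul_eq hε, mul_pow, mul_pow, ih, ← Complex.ofReal_pow,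
      Real.sq_sqrt hr]

theorem IsRaise.coeffE_normalised (hε : ε ≠ 0) (h : IsRaise k j μ μ') :
    (stateNorm ε μ)⁻¹ * coeffE ε μ μ' =
      (Real.sqrt (gtRadicandE k j μ) : ℂ) * (stateNorm ε μ')⁻¹ := by
  obtain ⟨h1, h2, h3, -⟩ := id h
  have hl := h.leftFactor_pos
  have hr := h.rightFactor_pos
  have e : leftFactor k j μ * Real.sqrt (rightFactor k j μ / leftFactor k j μ) =
      Real.sqrt (gtRadicandE k j μ) := by
    rw [gtRadicandE_eq h1 h2, ← Real.sqrt_sq hl.le, ← Real.sqrt_mul (by positivity),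
      Real.sqrt_sq hl.le]
    congr 1; field_simp
  have n0 := framingFactor_ne_zero hε h
  have n1 := stateNorm_ne_zero hε μ
  have n2 : (Real.sqrt (rightFactor k j μ / leftFactor k j μ) : ℂ) ≠ 0 := by
    exact_mod_cast (Real.sqrt_pos.2 (div_pos hr hl)).ne'
  rw [h.stateNorm_eq hε, h.coeffE_eq_div hε, ← e]
  push_cast
  field_simp

theorem IsRaise.coeffF_normalised (hε : ε ≠ 0) (h : IsRaise k j μ μ') :
    (stateNorm ε μ')⁻¹ * coeffF ε μ' μ =
      (Real.sqrt (gtRadicandF k j μ') : ℂ) * (stateNorm ε μ)⁻¹ := by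
  obtain ⟨h1, h2, h3, -⟩ := id h
  have hl := h.leftFactor_pos
  have hr := h.rightFactor_pos
  have e : Real.sqrt (gtRadicandF k j μ') * Real.sqrt (rightFactor k j μ / leftFactor k j μ) =
      rightFactor k j μ := by
    rw [h.gtRadicandF_eq, gtRadicandE_eq h1 h2, ← Real.sqrt_mul (by positivity),
      show leftFactor k j μ * rightFactor k j μ * (rightFactor k j μ / leftFactor k j μ) =
        rightFactor k j μ ^ 2 by field_simp, Real.sqrt_sq hr.le]
  have n0 := framingFactor_ne_zero hε h
  have n1 := stateNorm_ne_zero hε μ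
  have n2 : (Real.sqrt (rightFactor k j μ / leftFactor k j μ) : ℂ) ≠ 0 := by
    exact_mod_cast (Real.sqrt_pos.2 (div_pos hr hl)).ne'
  rw [h.stateNorm_eq hε, h.coeffF_eq_mul hε]
  nth_rw 2 [← e]
  push_cast
  field_simp

end Normalisation

end

end RectYangian

end

theorem mainTheorem5 (n p lam : ℕ) (hp : 1 ≤ p) (hpn : p < n) (ε : ℂ) (hε : ε ≠ 0) :
    -- the block matrices are the fixed points
    (∀ μ : RectYangian.RectPattern n p lam,
      (RectYangian.fixedPoint μ).IsCrystal n p lam ε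
        (RectYangian.phi ε μ) (RectYangian.rCharge μ) ∧
      (RectYangian.fixedPoint μ).FTerms n p lam ∧
      (RectYangian.fixedPoint μ).IsFixed n p lam ε (RectYangian.phi ε μ) ∧
      (RectYangian.fixedPoint μ).IsCyclic n p) ∧
    -- the equivariant coefficients
    (∀ (k j : ℕ) (μ μ' : RectYangian.RectPattern n p lam), RectYangian.IsRaise k j μ μ' →
      RectYangian.eul ε μ ≠ 0 ∧ RectYangian.eul ε μ' ≠ 0 ∧ RectYangian.eulInc ε μ μ' ≠ 0 ∧
      (k ≠ p →
        RectYangian.coeffE ε μ μ' = RectYangian.formulaE ε k j μ ∧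
        RectYangian.coeffF ε μ' μ = RectYangian.formulaF ε k j μ') ∧
      (k = p →
        RectYangian.coeffE ε μ μ' = RectYangian.formulaEp ε j μ ∧
        RectYangian.coeffF ε μ' μ = RectYangian.formulaFp ε j μ')) ∧
    -- the Gelfand-Tsetlin formulas at level zero
    (∀ (k j : ℕ) (μ μ' : RectYangian.RectPattern n p lam), RectYangian.IsRaise k j μ μ' →
      0 < RectYangian.gtRadicandE k j μ ∧ 0 < RectYangian.gtRadicandF k j μ') ∧
    ∃ N : RectYangian.RectPattern n p lam → ℂ,
      (∀ μ, N μ ≠ 0 ∧ N μ ^ 2 = RectYangian.eul ε μ) ∧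
      ∀ k, 1 ≤ k → k ≤ n - 1 →
        RectYangian.modeE ε k 0 ∘ₗ RectYangian.rescale N =
          RectYangian.rescale N ∘ₗ RectYangian.gtE k ∧
        RectYangian.modeF ε k 0 ∘ₗ RectYangian.rescale N =
          RectYangian.rescale N ∘ₗ RectYangian.gtF k := by
  refine ⟨fun μ => ?_, fun k j μ μ' h => ?_, fun k j μ μ' h => ?_, ?_⟩
  · have hc := RectYangian.fixedPoint_isCrystal hε μ
    exact ⟨hc, RectYangian.fixedPoint_fTerms hp hpn μ, hc.isFixed hp hpn,
      RectYangian.fixedPoint_isCyclic hpn μ⟩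
  · refine ⟨RectYangian.eul_ne_zero ε μ, RectYangian.eul_ne_zero ε μ',
      RectYangian.eulInc_ne_zero ε μ μ',
      fun hk => ⟨h.coeffE_unframed hε hk, h.coeffF_unframed hε hk⟩, ?_⟩
    rintro rfl
    exact ⟨h.coeffE_framed hε, h.coeffF_framed hε⟩
  · rw [h.gtRadicandF_eq, RectYangian.gtRadicandE_eq h.1 h.2.1, and_self]
    exact mul_pos h.leftFactor_pos h.rightFactor_pos
  · refine ⟨RectYangian.stateNorm ε, fun μ => ⟨RectYangian.stateNorm_ne_zero hε μ,
      RectYangian.stateNorm_sq hε μ⟩, fun k h1 h2 => ?_⟩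
    have hst : Finset.Icc (RectYangian.aIdx p k) (RectYangian.bIdx n p k) ⊆ Finset.Icc 1 k :=
      Finset.Icc_subset_Icc (le_max_left _ _) (min_le_right _ _)
    refine ⟨RectYangian.raisingOp_comp_rescale hst _
        (fun j μ μ' h => Finset.mem_Icc.2 ⟨h.aIdx_le, h.le_bIdx⟩) fun j μ μ' h => ?_,
      RectYangian.loweringOp_comp_rescale hst _
        (fun j μ μ' h => Finset.mem_Icc.2 ⟨h.aIdx_le, h.le_bIdx⟩) fun j μ μ' h => ?_⟩
    · rw [pow_zero, mul_one]; exact h.coeffE_normalised hε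
    · rw [pow_zero, mul_one]; exact h.coeffF_normalised hε
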